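/- Let $R$ be a field and $D$ a cocommutative pointed Hopf algebra over $R$ (every simple subcoalgebra is one-dimensional) of Birkhoff-Witt type: for every primitive $x\in D$ there is an infinite divided power sequence $d_0=1,\ d_1=x,\ d_2,\dots$ in $D$, i.e. $\Delta(d_n)=\sum_{i=0}^{n}d_i\otimes d_{n-i}$ for all $n$. A $D$-module algebra is a commutative $R$-algebra $A$ with a $D$-module structure such that $d(ab)=\sum(d_{(1)}a)(d_{(2)}b)$ and $d1=\varepsilon(d)1$; it is AS if it is artinian as a ring and simple (nonzero, with no $D$-stable ideals other than $0$ and $A$). For a $D$-module $V$ put $V^D=\{v\in V: dv=\varepsilon(d)v\ \text{for all } d\in D\}$. A $K\#D$-module is a $K$-module and $D$-module $V$ (with compatible $R$-actions) such that $d(av)=\sum(d_{(1)}a)(d_{(2)}v)$; it is cyclic if it is generated by one element. $D$ acts on tensor products over $K$ by $d(v\otimes w)=\sum d_{(1)}v\otimes d_{(2)}w$. Let $K\subset L$ be an inclusion of AS $D$-module algebras with $K^D=L^D$. For a subset $S\subset L$ let $K\langle S\rangle$ be the smallest AS $D$-module subalgebra of $L$ that includes $K$ and $S$; $L/K$ is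 finitely generated if $L=K\langle u_1,\dots,u_m\rangle$ for some $u_1,\dots,u_m\in L$. $L/K$ is a Picard-Vessiot (PV) extension if $K^D=L^D$ and there is a $D$-module subalgebra $K\subset A\subset L$ whose total quotient ring is $L$ and such that $(A\otimes_K A)^D$ generates $A\otimes_K A$ as a left $A$-module. For a $K\#D$-module $V$, $L/K$ is a minimal splitting algebra for $V$ if there is an injective $L\#D$-linear map $L\otimes_K V\to L^\Lambda$ for some set $\Lambda$, and $L=K\langle\{f(v): v\in V,\ f\in\mathrm{Hom}_{K\#D}(V,L)\}\rangle$. Then the following are equivalent: (a) $L/K$ is a finitely generated PV extension; (b) $L/K$ is a minimal splitting algebra for some cyclic $K\#D$-module of finite $K$-rank; (c) $L/K$ is a minimal splitting algebra for some $K\#D$-module of finite $K$-rank; (d) there are $n\ge 0$ and $X=(x_{ij})\in GL_n(L)$ that is $GL_n$-primitive in Kolchin's sense, i.e. $(dX)X^{-1}\in M_n(K)$ for every $d\in D$, where $dX=(dx_{ij})$, such that $L=K\langle x_{ij}\rangle$. -/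

import Mathlib

open scoped TensorProduct

universe u v

namespace PicardVessiot

/-! ### Conditions on the Hopf algebra `D` over the field `R` -/

section Coalgebra

variable (R : Type*) {D : Type*} [Field R] [Ring D] [HopfAlgebra R D]

/-- `C` is a subcoalgebra: `Δ(C) ⊆ C ⊗ C` inside `D ⊗ D`. -/
def IsSubcoalgebra (C : Submodule R D) : Prop :=
  ∀ c ∈ C, Coalgebra.comul (R := R) c ∈ LinearMap.range (TensorProduct.mapIncl C C)

/-- `C` is a simple subcoalgebra: it is nonzero and has no subcoalgebras but `0` and itself. -/
def IsSimpleSubcoalgebra (C : Submodule R D) : Prop :=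
  IsSubcoalgebra R C ∧ C ≠ ⊥ ∧ ∀ E : Submodule R D, IsSubcoalgebra R E → E ≤ C → E = ⊥ ∨ E = C

variable (D) in
/-- `D` is pointed: every simple subcoalgebra is one-dimensional. -/
def IsPointed : Prop :=
  ∀ C : Submodule R D, IsSimpleSubcoalgebra R C → Module.finrank R C = 1

/-- Primitive elements: `Δ(x) = x ⊗ 1 + 1 ⊗ x`. -/
def IsPrimitiveElement (x : D) : Prop :=
  Coalgebra.comul (R := R) x = x ⊗ₜ[R] (1 : D) + (1 : D) ⊗ₜ[R] x

/-- A divided power sequence of infinite length: `d 0 = 1` and `Δ(d n) = ∑ d i ⊗ d (n - i)`. Its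
terms span a subcoalgebra whose only simple subcoalgebra is `R • 1`, so they automatically lie in
the irreducible component of `1`. -/
def IsDividedPowerSequence (d : ℕ → D) : Prop :=
  d 0 = 1 ∧ ∀ n, Coalgebra.comul (R := R) (d n) =
    ∑ i ∈ Finset.range (n + 1), d i ⊗ₜ[R] d (n - i)

variable (D) in
/-- Birkhoff-Witt type: every primitive element `x` starts an infinite divided power sequence
`1, x, d 2, d 3, …`. -/
def IsBirkhoffWittType : Prop :=
  ∀ x : D, IsPrimitiveElement R x → ∃ d : ℕ → D, IsDividedPowerSequence R d ∧ d 1 = x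

end Coalgebra

/-! ### `D`-module algebras and `K # D`-modules -/

section SmashModule

variable (R D K V : Type*) [Field R] [Ring D] [HopfAlgebra R D]
  [CommRing K] [Algebra R K] [Module D K] [IsScalarTower R D K]
  [AddCommGroup V] [Module R V] [Module K V] [Module D V] [IsScalarTower R K V]
  [IsScalarTower R D V]

variable {K V} in
/-- The `R`-linear map `D ⊗ D → V`, `c ⊗ d ↦ (c a) (d v)`. -/
def smashAux (a : K) (v : V) : D ⊗[R] D →ₗ[R] V :=
  TensorProduct.lift <| LinearMap.mk₂ R (fun c d => (c • a) • (d • v))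
    (fun c c' d => by rw [add_smul, add_smul])
    (fun r c d => by rw [smul_assoc r c a, smul_assoc r (c • a)])
    (fun c d d' => by rw [add_smul, smul_add])
    (fun r c d => by rw [smul_assoc r d v, smul_comm (c • a) r])

/-- `V`, with its actions of `K` and of `D`, is a module over the smash product `K # D`:
`d (a v) = ∑ (d₍₁₎ a) (d₍₂₎ v)`. -/
class IsSmashModule : Prop where
  smul_smul_eq : ∀ (d : D) (a : K) (v : V),
    d • (a • v) = smashAux R D a v (Coalgebra.comul (R := R) d)

/-- `K` is a (commutative) `D`-module algebra: `d (a b) = ∑ (d₍₁₎ a) (d₍₂₎ b)`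
and `d 1 = ε(d) 1`. -/
class IsDModuleAlgebra : Prop extends IsSmashModule R D K K where
  smul_one_eq : ∀ d : D, d • (1 : K) = Coalgebra.counit (R := R) d • (1 : K)

end SmashModule

/-- The constants (`D`-invariants) `V^D = {v | d v = ε(d) v for all d}`. -/
def constants (R D V : Type*) [Field R] [Ring D] [HopfAlgebra R D]
    [AddCommGroup V] [Module R V] [Module D V] : Set V :=
  {v | ∀ d : D, d • v = Coalgebra.counit (R := R) d • v}

/-- `K` is AS: artinian as a ring and simple, i.e. nonzero and without nontrivial
`D`-stable ideals. -/
structure IsAS (D K : Type*) [Ring D] [CommRing K] [Module D K] : Prop where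
  artinian : IsArtinianRing K
  nontrivial : Nontrivial K
  simple : ∀ I : Ideal K, (∀ (d : D), ∀ a ∈ I, d • a ∈ I) → I = ⊥ ∨ I = ⊤

/-- The `K # D`-module `V` is cyclic, i.e. `V = (K # D) v` for some `v`. -/
def IsCyclicModule (D K V : Type*) [Ring D] [CommRing K]
    [AddCommGroup V] [Module K V] [Module D V] : Prop :=
  ∃ v : V, Submodule.span K (Set.range fun d : D => d • v) = ⊤

/-! ### The `D`-action on `V ⊗_K W` -/

section TensorAction

variable (R D K : Type*) {V W : Type*} [Field R] [Ring D] [HopfAlgebra R D]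
  [CommRing K] [Algebra R K] [Module D K] [IsScalarTower R D K]
  [AddCommGroup V] [Module R V] [Module K V] [Module D V] [IsScalarTower R K V]
  [IsScalarTower R D V]
  [AddCommGroup W] [Module R W] [Module K W] [Module D W] [IsScalarTower R K W]
  [IsScalarTower R D W]

/-- The map `D ⊗ D → V ⊗_K W`, `c ⊗ d ↦ (c v) ⊗ (d w)`. -/
def tensorAux (v : V) (w : W) : D ⊗[R] D →ₗ[R] V ⊗[K] W :=
  TensorProduct.lift <| LinearMap.mk₂ R (fun c d => (c • v) ⊗ₜ[K] (d • w))
    (fun c c' d => by rw [add_smul, TensorProduct.add_tmul])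
    (fun r c d => by rw [smul_assoc, TensorProduct.smul_tmul'])
    (fun c d d' => by rw [add_smul, TensorProduct.tmul_add])
    (fun r c d => by rw [smul_assoc, TensorProduct.tmul_smul])

variable {K}

/-- The map `D ⊗ (D ⊗ D) → V ⊗_K W`, `b ⊗ (c ⊗ d) ↦ (b a) ((c v) ⊗ (d w))`. -/
def tripleAux (a : K) (v : V) (w : W) : D ⊗[R] (D ⊗[R] D) →ₗ[R] V ⊗[K] W :=
  TensorProduct.lift <| LinearMap.mk₂ R (fun c t => (c • a) • tensorAux R D K v w t)
    (fun c c' t => by rw [add_smul, add_smul])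
    (fun r c t => by rw [smul_assoc r c a, smul_assoc])
    (fun c t t' => by rw [map_add, smul_add])
    (fun r c t => by rw [map_smul, smul_comm])

variable {R D}

theorem tripleAux_assoc (a : K) (v : V) (w : W) (s : D ⊗[R] D) (y : D) :
    tripleAux R D a v w (TensorProduct.assoc R D D D (s ⊗ₜ y)) =
      smashAux R D a v s ⊗ₜ[K] (y • w) := by
  induction s with
  | zero => simp
  | tmul b c => simp [tripleAux, tensorAux, smashAux, TensorProduct.smul_tmul']
  | add s t hs ht => rw [TensorProduct.add_tmul, map_add, map_add, hs, ht, map_add,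
      TensorProduct.add_tmul]

theorem tripleAux_leftComm (a : K) (v : V) (w : W) (x : D) (s : D ⊗[R] D) :
    tripleAux R D a v w (TensorProduct.leftComm R D D D (x ⊗ₜ s)) =
      (x • v) ⊗ₜ[K] smashAux R D a w s := by
  induction s with
  | zero => simp
  | tmul b c => simp [tripleAux, tensorAux, smashAux]
  | add s t hs ht => rw [TensorProduct.tmul_add, map_add, map_add, hs, ht, map_add,
      TensorProduct.tmul_add]

theorem leftComm_comul [Coalgebra.IsCocomm R D] (d : D) :
    TensorProduct.leftComm R D D D
        ((Coalgebra.comul (R := R) (A := D)).lTensor D (Coalgebra.comul (R := R) d)) =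
      (Coalgebra.comul (R := R) (A := D)).lTensor D (Coalgebra.comul (R := R) d) := by
  have key : ∀ (s : D ⊗[R] D) (y : D),
      TensorProduct.leftComm R D D D (TensorProduct.assoc R D D D (s ⊗ₜ y)) =
        TensorProduct.assoc R D D D (TensorProduct.comm R D D s ⊗ₜ y) := by
    intro s y
    induction s with
    | zero => simp
    | tmul b c => simp
    | add s t hs ht => simp only [TensorProduct.add_tmul, map_add, hs, ht]
  rw [← Coalgebra.coassoc_apply]
  induction Coalgebra.comul (R := R) d with
  | zero => simp
  | tmul b c => rw [LinearMap.rTensor_tmul, key, Coalgebra.comm_comul]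
  | add s t hs ht => simp only [map_add, hs, ht]

theorem tensorAux_balanced [Coalgebra.IsCocomm R D] [IsSmashModule R D K V]
    [IsSmashModule R D K W] (a : K) (v : V) (w : W) (d : D) :
    tensorAux R D K (a • v) w (Coalgebra.comul (R := R) d) =
      tensorAux R D K v (a • w) (Coalgebra.comul (R := R) d) := by
  have h₁ : ∀ t : D ⊗[R] D, tensorAux R D K (a • v) w t = tripleAux R D a v w
      (TensorProduct.assoc R D D D ((Coalgebra.comul (R := R) (A := D)).rTensor D t)) := by
    intro t
    induction t with
    | zero => simp
    | tmul x y =>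
      rw [LinearMap.rTensor_tmul, tripleAux_assoc, ← IsSmashModule.smul_smul_eq]
      simp [tensorAux]
    | add s t hs ht => simp only [map_add, hs, ht]
  have h₂ : ∀ t : D ⊗[R] D, tensorAux R D K v (a • w) t = tripleAux R D a v w
      (TensorProduct.leftComm R D D D ((Coalgebra.comul (R := R) (A := D)).lTensor D t)) := by
    intro t
    induction t with
    | zero => simp
    | tmul x y =>
      rw [LinearMap.lTensor_tmul, tripleAux_leftComm, ← IsSmashModule.smul_smul_eq]
      simp [tensorAux]
    | add s t hs ht => simp only [map_add, hs, ht]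
  rw [h₁, h₂, leftComm_comul, Coalgebra.coassoc_apply]

variable (R K V W)

/-- The action of `d ∈ D` on `V ⊗_K W` for `K # D`-modules `V`, `W`:
`d (v ⊗ w) = ∑ (d₍₁₎ v) ⊗ (d₍₂₎ w)`. -/
def tensorAct [Coalgebra.IsCocomm R D] [IsSmashModule R D K V]
    [IsSmashModule R D K W] (d : D) : V ⊗[K] W →+ V ⊗[K] W :=
  TensorProduct.liftAddHom
    (AddMonoidHom.mk' (fun v => AddMonoidHom.mk'
        (fun w => tensorAux R D K v w (Coalgebra.comul (R := R) d))
        (fun w w' => by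
          induction Coalgebra.comul (R := R) d with
          | zero => simp
          | tmul b c => simp [tensorAux, TensorProduct.tmul_add]
          | add s t hs ht => simp only [map_add, hs, ht]; abel))
      (fun v v' => by
        ext w
        simp only [AddMonoidHom.mk'_apply, AddMonoidHom.add_apply]
        induction Coalgebra.comul (R := R) d with
        | zero => simp
        | tmul b c => simp [tensorAux, TensorProduct.add_tmul]
        | add s t hs ht => simp only [map_add, hs, ht]; abel))
    (fun a v w => by simpa using tensorAux_balanced a v w d)

end TensorAction

/-! ### Inclusions `K ⊂ L` of `D`-module algebras -/

section Extension

/-- The algebra map `K → L` is `D`-linear. For AS `K` and `L` it is injective, so that `K` is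
identified with a `D`-module subalgebra of `L`. -/
class IsDExtension (D K L : Type*) [Ring D] [CommRing K] [CommRing L] [Algebra K L]
    [Module D K] [Module D L] : Prop where
  algebraMap_smul : ∀ (d : D) (a : K), algebraMap K L (d • a) = d • algebraMap K L a

/-- `D`-module subalgebras of `L` that include `K`. -/
structure DSubalgebra (D K L : Type*) [Ring D] [CommRing K] [CommRing L] [Algebra K L]
    [Module D L] extends Subalgebra K L where
  smul_mem' : ∀ (d : D) (a : L), a ∈ carrier → d • a ∈ carrier

section Instances

variable {R D K L : Type*} [Field R] [Ring D] [HopfAlgebra R D]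
  [CommRing K] [Algebra R K] [Module D K] [IsScalarTower R D K]
  [CommRing L] [Algebra R L] [Module D L] [IsScalarTower R D L]
  [Algebra K L] [IsScalarTower R K L] (A : DSubalgebra D K L)

instance : Module D A.toSubalgebra where
  smul d a := ⟨d • (a : L), A.smul_mem' d a a.2⟩
  one_smul a := Subtype.ext (one_smul D (a : L))
  mul_smul c d a := Subtype.ext (mul_smul c d (a : L))
  smul_zero d := Subtype.ext (smul_zero d)
  smul_add d a b := Subtype.ext (smul_add d (a : L) b)
  add_smul c d a := Subtype.ext (add_smul c d (a : L))
  zero_smul a := Subtype.ext (zero_smul D (a : L))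

theorem DSubalgebra.coe_smul {D K L : Type*} [Ring D] [CommRing K] [CommRing L] [Algebra K L]
    [Module D L] (A : DSubalgebra D K L) (d : D) (a : A.toSubalgebra) :
    ((d • a : A.toSubalgebra) : L) = d • (a : L) := rfl

instance : IsScalarTower R D A.toSubalgebra where
  smul_assoc r d a := Subtype.ext (smul_assoc r d (a : L))

theorem smashAux_algebraMap [IsDExtension D K L] (a : K) (v : L) (t : D ⊗[R] D) :
    smashAux R D a v t = smashAux R D (algebraMap K L a) v t := by
  induction t with
  | zero => simp
  | tmul b c => simp [smashAux, Algebra.smul_def, IsDExtension.algebraMap_smul]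
  | add s t hs ht => simp only [map_add, hs, ht]

instance [IsDExtension D K L] [IsDModuleAlgebra R D L] : IsSmashModule R D K L where
  smul_smul_eq d a v := by
    rw [smashAux_algebraMap, ← IsSmashModule.smul_smul_eq, Algebra.smul_def, smul_eq_mul]

instance [IsDExtension D K L] [IsDModuleAlgebra R D L] :
    IsSmashModule R D K A.toSubalgebra where
  smul_smul_eq d a v := by
    have h : ∀ t : D ⊗[R] D,
        ((smashAux R D a v t : A.toSubalgebra) : L) = smashAux R D a (v : L) t := by
      intro t
      induction t with
      | zero => simp
      | tmul b c => simp [smashAux, DSubalgebra.coe_smul]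
      | add s t hs ht => simp only [map_add, ← hs, ← ht]; rfl
    apply Subtype.ext
    rw [h, ← IsSmashModule.smul_smul_eq]
    rfl

end Instances

/-- `K⟨S⟩`: the smallest AS `D`-module subalgebra of `L` that includes `K` and `S`, as the
intersection of all of them. -/
def adjoin (D K : Type*) {L : Type*} [Ring D] [CommRing K] [CommRing L] [Algebra K L]
    [Module D L] (S : Set L) : Subalgebra K L :=
  sInf {B | ∃ M : DSubalgebra D K L, IsAS D M.toSubalgebra ∧ S ⊆ M.carrier ∧ M.toSubalgebra = B}

/-- `L/K` is finitely generated: `L = K⟨u₁, …, u_m⟩`. -/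
def IsFinitelyGenerated (D K L : Type*) [Ring D] [CommRing K] [CommRing L] [Algebra K L]
    [Module D L] : Prop :=
  ∃ S : Finset L, adjoin D K (S : Set L) = ⊤

variable (R D K L : Type*) [Field R] [Ring D] [HopfAlgebra R D]
  [CommRing K] [Algebra R K] [Module D K] [IsScalarTower R D K]
  [CommRing L] [Algebra R L] [Module D L] [IsScalarTower R D L]
  [Algebra K L] [IsScalarTower R K L]

/-- `K^D = L^D`, inside `L`. -/
def SameConstants : Prop :=
  algebraMap K L '' constants R D K = constants R D L

variable [Coalgebra.IsCocomm R D] [IsDModuleAlgebra R D L] [IsDExtension D K L]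

/-- The set `H = (A ⊗_K A)^D` of constants of `A ⊗_K A`, on which `D` acts by
`d (a ⊗ b) = ∑ (d₍₁₎ a) ⊗ (d₍₂₎ b)`. -/
def tensorConstants {D K L : Type*} [Ring D] [HopfAlgebra R D]
    [CommRing K] [Algebra R K] [Module D K] [IsScalarTower R D K]
    [CommRing L] [Algebra R L] [Module D L] [IsScalarTower R D L]
    [Algebra K L] [IsScalarTower R K L]
    [Coalgebra.IsCocomm R D] [IsDModuleAlgebra R D L] [IsDExtension D K L]
    (A : DSubalgebra D K L) : Set (A.toSubalgebra ⊗[K] A.toSubalgebra) :=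
  {h | ∀ d : D, tensorAct R K A.toSubalgebra A.toSubalgebra d h =
    Coalgebra.counit (R := R) d • h}

/-- The inclusion `K ⊂ L` of AS `D`-module algebras is a Picard-Vessiot extension: `K^D = L^D`,
and there is a `D`-module algebra `K ⊂ A ⊂ L` whose total quotient ring is `L` and for which
`(A ⊗_K A)^D` generates `A ⊗_K A` as a left `A`-module. -/
def IsPVExtension : Prop :=
  SameConstants R D K L ∧ ∃ A : DSubalgebra D K L, IsFractionRing A.toSubalgebra L ∧
    Submodule.span A.toSubalgebra (tensorConstants R A) = ⊤

/-! ### Splitting algebras -/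

variable (V : Type*) [AddCommGroup V] [Module R V] [Module K V] [Module D V]
  [IsScalarTower R K V] [IsScalarTower R D V] [IsSmashModule R D K V]

/-- `L/K` is a splitting algebra for the `K # D`-module `V`: there is an injective
`L # D`-linear map from `L ⊗_K V` to some power of `L`. -/
def IsSplittingAlgebra (R : Type*) (D : Type*) (K : Type*) (L : Type u) (V : Type v)
    [Field R] [Ring D] [HopfAlgebra R D]
    [CommRing K] [Algebra R K] [Module D K] [IsScalarTower R D K]
    [CommRing L] [Algebra R L] [Module D L] [IsScalarTower R D L]
    [Algebra K L] [IsScalarTower R K L]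
    [Coalgebra.IsCocomm R D] [IsDModuleAlgebra R D L] [IsDExtension D K L]
    [AddCommGroup V] [Module R V] [Module K V] [Module D V]
    [IsScalarTower R K V] [IsScalarTower R D V] [IsSmashModule R D K V] : Prop :=
  ∃ (Λ : Type (max u v)) (φ : L ⊗[K] V →ₗ[L] (Λ → L)), Function.Injective φ ∧
    ∀ (d : D) (x : L ⊗[K] V), φ (tensorAct R K L V d x) = d • φ x

/-- The set of all values `f v`, where `v ∈ V` and `f : V → L` is `K # D`-linear. -/
def solutionSet (D K L V : Type*) [Ring D] [CommRing K] [CommRing L] [Algebra K L]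
    [Module D L] [AddCommGroup V] [Module K V] [Module D V] : Set L :=
  {x | ∃ f : V →ₗ[K] L, (∀ (d : D) (v : V), f (d • v) = d • f v) ∧ ∃ v, f v = x}

/-- `L/K` is a minimal splitting algebra for `V`: `V` splits in `L/K` and `L = K⟨V⟩`. -/
def IsMinimalSplittingAlgebra : Prop :=
  IsSplittingAlgebra R D K L V ∧ adjoin D K (solutionSet D K L V) = ⊤

end Extension

/-- `X ∈ GL_n(L)` is `GL_n`-primitive over `K`: `(d X) X⁻¹ ∈ M_n(K)` for every `d ∈ D`, where
`d X` is obtained by applying `d` to the entries of `X`. -/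
def IsGLPrimitive (D K : Type*) {L : Type*} [Ring D] [CommRing K] [CommRing L] [Algebra K L]
    [Module D L] {n : ℕ} (X : Matrix.GeneralLinearGroup (Fin n) L) : Prop :=
  ∀ d : D, ∃ C : Matrix (Fin n) (Fin n) K,
    (X : Matrix (Fin n) (Fin n) L).map (fun x => d • x) * (X⁻¹ : Matrix.GeneralLinearGroup (Fin n) L) =
      C.map (algebraMap K L)

end PicardVessiot

/-!
Call an element `h` of a tensor product `L ⊗_K M` a constant if `d h = ε(d) h` for all
`d ∈ D`. Simplicity of `L` enters in two ways.

* Constants that generate `L ⊗_K M` over `L` contain an `L`-basis, since `d (x h) = (d x) h` for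
  constant `h`, so that ideals of coefficients are `D`-stable (`exists_basis_of_horizontal`). As `K`
  and `L` are artinian and `K → L` is injective, freeness of `L ⊗_K M` descends to `M`, even if `M`
  is not finitely generated (`nonempty_basis_of_baseChange`).
* The grouplike elements of the pointed Hopf algebra `D` act transitively on the maximal ideals of
  `L` (`exists_groupLike_comap_eq`). Therefore a noetherian `D`-module subalgebra of `L` that is
  closed under inverses is AS (`isAS_of_inverseClosed`), and `K⟨S⟩` consists of fractions when the
  `K`-algebra generated by `S` is `D`-stable and noetherian.

From a module to a matrix: if `L ⊗_K V` embeds into a power of `L`, then finitely many coordinates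
make it isomorphic to `L^n`. They restrict to `n` solutions `V → L`, and their values on a `K`-basis
of `V` form a `GL_n`-primitive matrix; every other solution is a combination of these with constant
coefficients, which lie in `K` (`exists_glPrimitive`).

From a Picard-Vessiot extension to a matrix: `L ⊗_K A` has a basis of constants, so `A` is free and
`L` is faithfully flat over `K`, and expanding `1 ⊗ a` in that basis shows that `D a` lies in a
finitely generated `K`-module. Numerators and denominators of generators of `L` thus span a
`K # D`-submodule `V` of finite rank in `A`, and the coordinates with respect to the constants split
`L ⊗_K V ⊆ L ⊗_K A` (`exists_glPrimitive_of_pv`).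

From a matrix `X`: with `A = K[X, X⁻¹]`, the entries of `X⁻¹ ⊗ X` and of its inverse are constants
that generate `A ⊗_K A` over `A` (`isPVExtension_of_glPrimitive`). The `K # D`-submodule of `M_n(L)`
generated by `X` lies in `M_n(K) X`, so that by flatness it splits in `L`; it is cyclic and its
coordinates are solutions with values `x_{ij}` on `X` (`exists_cyclic_of_glPrimitive`).
-/

namespace PicardVessiot

/-! ### The diagonal action of `D` on tensor products -/

section Sweedler

variable {R D : Type*} [Field R] [Ring D] [HopfAlgebra R D]

theorem sum_counit_smul_left {ι : Type*} {d : D} (r : Coalgebra.Repr R d ι) :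
    ∑ i ∈ r.index, Coalgebra.counit (R := R) (r.right i) • r.left i = d := by
  simpa only [map_sum, TensorProduct.lift.tmul, LinearMap.flip_apply, LinearMap.lsmul_apply,
    one_smul] using
      congr(TensorProduct.lift (LinearMap.lsmul R D).flip $(Coalgebra.sum_tmul_counit_eq r))

section

variable {K V : Type*} [CommRing K] [Algebra R K] [Module D K] [IsScalarTower R D K]
  [AddCommGroup V] [Module R V] [Module K V] [Module D V] [IsScalarTower R K V]
  [IsScalarTower R D V]

@[simp]
theorem smashAux_tmul (a : K) (v : V) (c d : D) :
    smashAux R D a v (c ⊗ₜ d) = (c • a) • (d • v) := rfl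

variable {W : Type*} [AddCommGroup W] [Module R W] [Module K W] [Module D W]
  [IsScalarTower R K W] [IsScalarTower R D W]

omit [Module D K] [IsScalarTower R D K] in
@[simp]
theorem tensorAux_tmul (v : V) (w : W) (c d : D) :
    tensorAux R D K v w (c ⊗ₜ d) = (c • v) ⊗ₜ[K] (d • w) := rfl

variable (R) in
/-- `d (a v) = ∑ (d₍₁₎ a) (d₍₂₎ v)` for a given presentation of `Δ d`. -/
theorem smul_smul_repr [IsSmashModule R D K V] {ι : Type*} {d : D} (r : Coalgebra.Repr R d ι)
    (a : K) (v : V) : d • (a • v) = ∑ i ∈ r.index, (r.left i • a) • (r.right i • v) := by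
  rw [IsSmashModule.smul_smul_eq (R := R), ← r.eq, map_sum]
  rfl

end

section

variable {K : Type*} [CommRing K] [Algebra R K] [Module D K] [IsScalarTower R D K]

variable (R) in
theorem smul_mul_repr [IsDModuleAlgebra R D K] {ι : Type*} {d : D} (r : Coalgebra.Repr R d ι)
    (a b : K) : d • (a * b) = ∑ i ∈ r.index, (r.left i • a) * (r.right i • b) :=
  smul_smul_repr R r a b

end

section Tensor

variable {K V W : Type*} [CommRing K] [Algebra R K] [Module D K] [IsScalarTower R D K]
  [AddCommGroup V] [Module R V] [Module K V] [Module D V] [IsScalarTower R K V]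
  [IsScalarTower R D V]
  [AddCommGroup W] [Module R W] [Module K W] [Module D W] [IsScalarTower R K W]
  [IsScalarTower R D W]
  [Coalgebra.IsCocomm R D] [IsSmashModule R D K V] [IsSmashModule R D K W]

@[simp]
theorem tensorAct_tmul (d : D) (v : V) (w : W) :
    tensorAct R K V W d (v ⊗ₜ w) = tensorAux R D K v w (Coalgebra.comul (R := R) d) := rfl

theorem tensorAct_tmul_repr {ι : Type*} {d : D} (r : Coalgebra.Repr R d ι) (v : V) (w : W) :
    tensorAct R K V W d (v ⊗ₜ w) = ∑ i ∈ r.index, (r.left i • v) ⊗ₜ[K] (r.right i • w) := by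
  rw [tensorAct_tmul, ← r.eq, map_sum]
  rfl

theorem tensorAct_map {V' W' : Type*}
    [AddCommGroup V'] [Module R V'] [Module K V'] [Module D V'] [IsScalarTower R K V']
    [IsScalarTower R D V']
    [AddCommGroup W'] [Module R W'] [Module K W'] [Module D W'] [IsScalarTower R K W']
    [IsScalarTower R D W'] [IsSmashModule R D K V'] [IsSmashModule R D K W']
    (f : V →ₗ[K] V') (g : W →ₗ[K] W') (hf : ∀ (d : D) v, f (d • v) = d • f v)
    (hg : ∀ (d : D) w, g (d • w) = d • g w) (d : D) (t : V ⊗[K] W) :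
    tensorAct R K V' W' d (TensorProduct.map f g t) =
      TensorProduct.map f g (tensorAct R K V W d t) := by
  induction t with
  | zero => simp
  | tmul v w =>
    rw [TensorProduct.map_tmul, tensorAct_tmul, tensorAct_tmul]
    induction Coalgebra.comul (R := R) d with
    | zero => simp
    | tmul b c => simp [hf, hg]
    | add s t hs ht => simp only [map_add, hs, ht]
  | add s t hs ht => simp only [map_add, hs, ht]

theorem tensorAct_comm (d : D) (t : V ⊗[K] W) :
    tensorAct R K W V d (TensorProduct.comm K V W t) =
      TensorProduct.comm K V W (tensorAct R K V W d t) := by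
  induction t with
  | zero => simp
  | tmul v w =>
    rw [TensorProduct.comm_tmul, tensorAct_tmul, tensorAct_tmul, ← Coalgebra.comm_comul R d]
    conv_rhs => rw [Coalgebra.comm_comul R d]
    induction Coalgebra.comul (R := R) d with
    | zero => simp
    | tmul b c => simp
    | add s t hs ht => simp only [map_add, hs, ht]
  | add s t hs ht => simp only [map_add, hs, ht]

end Tensor

section TensorAlgebra

variable {K B W : Type*} [CommRing K] [Algebra R K] [Module D K] [IsScalarTower R D K]
  [CommRing B] [Algebra R B] [Module D B] [IsScalarTower R D B] [Algebra K B]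
  [IsScalarTower R K B]
  [AddCommGroup W] [Module R W] [Module K W] [Module D W] [IsScalarTower R K W]
  [IsScalarTower R D W]
  [Coalgebra.IsCocomm R D] [IsDModuleAlgebra R D B] [IsSmashModule R D K B]
  [IsSmashModule R D K W]

theorem tensorAct_smul_repr {ι : Type*} {d : D} (r : Coalgebra.Repr R d ι) (b : B)
    (t : B ⊗[K] W) : tensorAct R K B W d (b • t) =
      ∑ i ∈ r.index, (r.left i • b) • tensorAct R K B W (r.right i) t := by
  induction t with
  | zero => simp
  | add s t hs ht => simp only [smul_add, map_add, hs, ht, Finset.sum_add_distrib]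
  | tmul v w =>
    let P : D ⊗[R] (D ⊗[R] D) →ₗ[R] B ⊗[K] W :=
      TensorProduct.lift <| LinearMap.mk₂ R (fun c t => (c • b) • tensorAux R D K v w t)
        (fun c c' t => by rw [add_smul, add_smul])
        (fun r c t => by rw [smul_assoc r c b, smul_assoc])
        (fun c t t' => by rw [map_add, smul_add])
        (fun r c t => by rw [map_smul, smul_comm])
    have h₁ : ∀ t : D ⊗[R] D, tensorAux R D K (b * v) w t = P
        (TensorProduct.assoc R D D D ((Coalgebra.comul (R := R) (A := D)).rTensor D t)) := by
      intro t
      induction t with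
      | zero => simp
      | add s t hs ht => simp only [map_add, hs, ht]
      | tmul x y =>
        have h : ∀ s : D ⊗[R] D, P (TensorProduct.assoc R D D D (s ⊗ₜ y)) =
            smashAux R D b v s ⊗ₜ[K] (y • w) := by
          intro s
          induction s with
          | zero => simp
          | tmul c d => simp [P, TensorProduct.smul_tmul']
          | add s t hs ht => rw [TensorProduct.add_tmul, map_add, map_add, hs, ht, map_add,
              TensorProduct.add_tmul]
        rw [LinearMap.rTensor_tmul, h, ← IsSmashModule.smul_smul_eq]
        simp
    rw [TensorProduct.smul_tmul', smul_eq_mul, tensorAct_tmul, h₁, Coalgebra.coassoc_apply,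
      ← r.eq, map_sum, map_sum]
    rfl

/-- Left multiplication moves past constants: if `h ∈ B ⊗_K W` is a constant then
`d (b h) = (d b) h`. -/
theorem tensorAct_smul_of_const {h : B ⊗[K] W}
    (hh : ∀ d : D, tensorAct R K B W d h = Coalgebra.counit (R := R) d • h) (d : D) (b : B) :
    tensorAct R K B W d (b • h) = (d • b) • h := by
  rw [tensorAct_smul_repr (Coalgebra.Repr.arbitrary R d) b h]
  conv_rhs => rw [← sum_counit_smul_left (Coalgebra.Repr.arbitrary R d), Finset.sum_smul,
    Finset.sum_smul]
  refine Finset.sum_congr rfl fun i _ => ?_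
  rw [hh, smul_assoc (_ : R) (_ : D) b, smul_assoc (_ : R) (_ : B) h, smul_comm]

theorem tensorAct_one_tmul (d : D) (w : W) :
    tensorAct R K B W d ((1 : B) ⊗ₜ w) = (1 : B) ⊗ₜ (d • w) := by
  rw [tensorAct_tmul_repr (Coalgebra.Repr.arbitrary R d)]
  conv_rhs => rw [← Coalgebra.sum_counit_smul (Coalgebra.Repr.arbitrary R d)]
  rw [Finset.sum_smul, TensorProduct.tmul_sum]
  refine Finset.sum_congr rfl fun i _ => ?_
  rw [IsDModuleAlgebra.smul_one_eq (R := R), smul_assoc (_ : R) (_ : D) w,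
    TensorProduct.tmul_smul (_ : R), TensorProduct.smul_tmul']

end TensorAlgebra

section TensorSquare

variable {K B : Type*} [CommRing K] [Algebra R K] [Module D K] [IsScalarTower R D K]
  [CommRing B] [Algebra R B] [Module D B] [IsScalarTower R D B] [Algebra K B]
  [IsScalarTower R K B]
  [Coalgebra.IsCocomm R D] [IsDModuleAlgebra R D B] [IsSmashModule R D K B]

theorem tensorAct_mul_of_const {h : B ⊗[K] B}
    (hh : ∀ d : D, tensorAct R K B B d h = Coalgebra.counit (R := R) d • h) (d : D)
    (t : B ⊗[K] B) : tensorAct R K B B d (t * h) = tensorAct R K B B d t * h := by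
  induction t with
  | zero => simp
  | add s t hs ht => simp only [map_add, add_mul, hs, ht]
  | tmul a b =>
    have hcomm : ∀ x y : B ⊗[K] B, TensorProduct.comm K B B (x * y) =
        TensorProduct.comm K B B x * TensorProduct.comm K B B y :=
      fun x y => map_mul (Algebra.TensorProduct.comm K B B) x y
    have key : ∀ (d : D) (b : B), tensorAct R K B B d (((1 : B) ⊗ₜ[K] b) * h) =
        ((1 : B) ⊗ₜ[K] (d • b)) * h := by
      intro d b
      apply (TensorProduct.comm K B B).injective
      have hh' : ∀ d : D, tensorAct R K B B d (TensorProduct.comm K B B h) =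
          Coalgebra.counit (R := R) d • TensorProduct.comm K B B h := by
        intro d
        rw [tensorAct_comm, hh, ← algebraMap_smul K, map_smul, algebraMap_smul]
      have := tensorAct_smul_of_const hh' d b
      rw [← tensorAct_comm, hcomm, hcomm, TensorProduct.comm_tmul, TensorProduct.comm_tmul]
      simpa [Algebra.smul_def] using this
    have e : ∀ (x y : B) (z : B ⊗[K] B), (x ⊗ₜ[K] y) * z = x • (((1 : B) ⊗ₜ[K] y) * z) := by
      intro x y z
      rw [← smul_mul_assoc, TensorProduct.smul_tmul', smul_eq_mul, mul_one]
    rw [e, tensorAct_smul_repr (Coalgebra.Repr.arbitrary R d),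
      tensorAct_tmul_repr (Coalgebra.Repr.arbitrary R d), Finset.sum_mul]
    refine Finset.sum_congr rfl fun i _ => ?_
    rw [key, ← e]

end TensorSquare

end Sweedler

section

variable {R D K L : Type*} [Field R] [Ring D] [HopfAlgebra R D]
  [CommRing K] [Algebra R K] [Module D K] [IsScalarTower R D K]
  [CommRing L] [Algebra R L] [Module D L] [IsScalarTower R D L]
  [Algebra K L] [IsScalarTower R K L] (A : DSubalgebra D K L)

instance [IsDModuleAlgebra R D L] : IsDModuleAlgebra R D A.toSubalgebra where
  smul_smul_eq d a v := by
    have h : ∀ t : D ⊗[R] D,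
        ((smashAux R D a v t : A.toSubalgebra) : L) = smashAux R D (a : L) (v : L) t := by
      intro t
      induction t with
      | zero => simp
      | tmul b c => simp [DSubalgebra.coe_smul]
      | add s t hs ht => simp only [map_add, ← hs, ← ht]; rfl
    apply Subtype.ext
    rw [h, ← IsSmashModule.smul_smul_eq]
    rfl
  smul_one_eq d := Subtype.ext (IsDModuleAlgebra.smul_one_eq (R := R) (K := L) d)

end

/-! ### Descent of freeness along injections of artinian rings -/

section Descent

variable {K L : Type*} [CommRing K] [CommRing L] [Algebra K L]

theorem exists_isPrime_comap_eq [IsArtinianRing K] (hinj : Function.Injective (algebraMap K L))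
    (m : Ideal K) [hm : m.IsMaximal] :
    ∃ n : Ideal L, n.IsPrime ∧ n.comap (algebraMap K L) = m := by
  apply Ideal.exists_comap_eq_of_mem_minimalPrimes_of_injective hinj
  refine ⟨⟨hm.isPrime, bot_le⟩, fun q hq hqm => ?_⟩
  have := hq.1
  exact ((IsArtinianRing.isMaximal_of_isPrime q).eq_of_le hm.ne_top hqm).ge

/-- Over an artinian ring, elements of a flat module that are linearly independent in every
residue fibre are linearly independent: a relation among them would give one whose coefficients
are killed by a maximal ideal `P`, and a functional on the vector space of such coefficients turns
it into a relation over `L ⧸ P`. -/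
theorem linearIndependent_of_residue {F ι : Type*} [IsArtinianRing L] [AddCommGroup F] [Module L F]
    [Module.Flat L F] (v : ι → F)
    (h : ∀ P : Ideal L, P.IsMaximal →
      LinearIndependent (L ⧸ P) (fun i => (1 : L ⧸ P) ⊗ₜ[L] v i)) :
    LinearIndependent L v := by
  rw [LinearIndependent, ← LinearMap.ker_eq_bot]
  by_contra hN
  set N := LinearMap.ker (Finsupp.linearCombination L v) with hNdef
  obtain ⟨x₀, hx₀, hx₀'⟩ := (Submodule.ne_bot_iff N).1 hN
  obtain ⟨P, hP, -⟩ := exists_le_isAssociatedPrime_of_isNoetherianRing L (⟨x₀, hx₀⟩ : N)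
    (by simpa using hx₀')
  obtain ⟨hPp, f, hf⟩ := (isAssociatedPrime_iff_exists_injective_linearMap P N).1 hP
  have hPmax : P.IsMaximal := IsArtinianRing.isMaximal_of_isPrime P
  let _ : Field (L ⧸ P) := Ideal.Quotient.field P
  let U := Submodule.torsionBySet L L (P : Set L)
  let x : ι →₀ L := (f 1 : N)
  have hx : x ≠ 0 := by
    intro h0
    have : f 1 = 0 := Subtype.ext h0
    exact one_ne_zero (hf (this.trans (map_zero f).symm))
  have hxU : ∀ i, x i ∈ U := by
    intro i
    rw [Submodule.mem_torsionBySet_iff]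
    intro a
    have h1 : (a : L) • f 1 = 0 := by
      rw [← map_smul]
      have : (a : L) • (1 : L ⧸ P) = 0 := by
        rw [Algebra.smul_def, mul_one]
        exact Ideal.Quotient.eq_zero_iff_mem.2 a.2
      rw [this, map_zero]
    have h2 : (a : L) • x = 0 := congrArg Subtype.val h1
    exact DFunLike.congr_fun h2 i
  have hxN : Finsupp.linearCombination L v x = 0 := (f 1 : N).2
  obtain ⟨i₀, hi₀⟩ := Finsupp.ne_iff.1 hx
  obtain ⟨g, hg⟩ : ∃ g : Module.Dual (L ⧸ P) U, g ⟨x i₀, hxU i₀⟩ ≠ 0 := by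
    by_contra! hall
    have := (Module.forall_dual_apply_eq_zero_iff (L ⧸ P) _).1 hall
    exact hi₀ (congrArg Subtype.val this)
  have hflat := Module.Flat.rTensor_preserves_injective_linearMap (M := F) U.subtype
    U.injective_subtype
  let t : U ⊗[L] F := ∑ i ∈ x.support, (⟨x i, hxU i⟩ : U) ⊗ₜ[L] v i
  have ht : t = 0 := by
    apply hflat
    apply (TensorProduct.lid L F).injective
    simpa [t, Finsupp.linearCombination_apply, Finsupp.sum] using hxN
  have h3 := congrArg (LinearMap.rTensor F (g.restrictScalars L)) ht
  simp only [t, map_sum, LinearMap.rTensor_tmul, map_zero] at h3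
  have h4 := linearIndependent_iff'.1 (h P hPmax) x.support (fun i => g ⟨x i, hxU i⟩)
    (by simpa [TensorProduct.smul_tmul'] using h3) i₀ (by simpa using hi₀)
  exact hg h4

variable {M : Type*} [AddCommGroup M] [Module K M]

/-- If `L ⊗_K M` is free with a basis indexed by `B`, then so is every residue fibre of `M`. -/
theorem nonempty_basis_residue {B : Type*} [IsArtinianRing K] [IsArtinianRing L]
    (hinj : Function.Injective (algebraMap K L)) (b : Module.Basis B L (L ⊗[K] M))
    (m : Ideal K) [hm : m.IsMaximal] :
    Nonempty (Module.Basis B (K ⧸ m) ((K ⧸ m) ⊗[K] M)) := by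
  obtain ⟨n, hn, hnm⟩ := exists_isPrime_comap_eq hinj m
  have hnmax : n.IsMaximal := IsArtinianRing.isMaximal_of_isPrime n
  have : n.LiesOver m := ⟨hnm.symm⟩
  let _ : Field (K ⧸ m) := Ideal.Quotient.field m
  let _ : Field (L ⧸ n) := Ideal.Quotient.field n
  let β₀ := Module.Basis.ofVectorSpace (K ⧸ m) ((K ⧸ m) ⊗[K] M)
  let β₁ := (β₀.baseChange (L ⧸ n)).map
    (TensorProduct.AlgebraTensorModule.cancelBaseChange K (K ⧸ m) (L ⧸ n) (L ⧸ n) M)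
  let β₂ := (b.baseChange (L ⧸ n)).map
    (TensorProduct.AlgebraTensorModule.cancelBaseChange K L (L ⧸ n) (L ⧸ n) M)
  exact ⟨β₀.reindex (β₁.indexEquiv β₂)⟩

/-- Bases of all residue fibres of `M` that are indexed by the same set lift to one family in
`M`. -/
theorem exists_lift_basis_residue {B : Type*} [IsArtinianRing K]
    (β : ∀ m : MaximalSpectrum K,
      Module.Basis B (K ⧸ m.asIdeal) ((K ⧸ m.asIdeal) ⊗[K] M)) :
    ∃ w : B → M, ∀ (m : MaximalSpectrum K) (i : B),
      (1 : K ⧸ m.asIdeal) ⊗ₜ[K] w i = β m i := by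
  classical
  have : Fintype (MaximalSpectrum K) := Fintype.ofFinite _
  have hsurj : ∀ (m : MaximalSpectrum K) (y : (K ⧸ m.asIdeal) ⊗[K] M),
      ∃ x : M, (1 : K ⧸ m.asIdeal) ⊗ₜ[K] x = y := fun m =>
    TensorProduct.mk_surjective K M (K ⧸ m.asIdeal) Ideal.Quotient.mk_surjective
  choose x hx using fun m i => hsurj m (β m i)
  have hcop : Pairwise (Function.onFun IsCoprime fun m : MaximalSpectrum K => m.asIdeal) := by
    intro m m' hne
    exact Ideal.isCoprime_of_isMaximal fun h => hne (MaximalSpectrum.ext h)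
  choose e he using fun m : MaximalSpectrum K =>
    Ideal.exists_forall_sub_mem_ideal hcop (fun m' => if m = m' then (1 : K) else 0)
  refine ⟨fun i => ∑ m, e m • x m i, fun m' i => ?_⟩
  have he' : ∀ m, (Ideal.Quotient.mk m'.asIdeal) (e m) = if m = m' then 1 else 0 := by
    intro m
    have := Ideal.Quotient.eq.2 (he m m')
    rw [this]
    split_ifs <;> simp
  rw [TensorProduct.tmul_sum, Finset.sum_eq_single m', TensorProduct.tmul_smul,
    TensorProduct.smul_tmul', Algebra.smul_def, mul_one]
  · have := he' m'
    rw [if_pos rfl] at this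
    rw [Ideal.Quotient.algebraMap_eq, this, hx]
  · intro m _ hne
    have := he' m
    rw [if_neg hne] at this
    rw [TensorProduct.tmul_smul,
      TensorProduct.smul_tmul', Algebra.smul_def, mul_one, Ideal.Quotient.algebraMap_eq, this,
      TensorProduct.zero_tmul]
  · simp

/-- Nakayama's lemma over an artinian ring, without finiteness of the module. -/
theorem subsingleton_of_forall_smul_eq_top [IsArtinianRing K]
    (h : ∀ m : Ideal K, m.IsMaximal → m • (⊤ : Submodule K M) = ⊤) : Subsingleton M := by
  classical
  have : Fintype (MaximalSpectrum K) := Fintype.ofFinite _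
  have hprod : (∏ m : MaximalSpectrum K, m.asIdeal) • (⊤ : Submodule K M) = ⊤ := by
    induction (Finset.univ : Finset (MaximalSpectrum K)) using Finset.induction_on with
    | empty => simp
    | insert m s hm ih => rw [Finset.prod_insert hm, Submodule.mul_smul, ih, h _ m.isMaximal]
  have hle : (∏ m : MaximalSpectrum K, m.asIdeal) ≤ Ideal.jacobson ⊥ := by
    rw [Ideal.jacobson]
    refine le_sInf fun m hm => ?_
    exact (Ideal.prod_le_inf).trans
      (Finset.inf_le (f := MaximalSpectrum.asIdeal) (Finset.mem_univ ⟨m, hm.2⟩))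
  have hjac : Ideal.jacobson (⊥ : Ideal K) • (⊤ : Submodule K M) = ⊤ :=
    top_le_iff.1 (hprod.symm.le.trans (Submodule.smul_mono_left hle))
  obtain ⟨k, hk⟩ := IsArtinianRing.isNilpotent_jacobson_bot (R := K)
  have hpow : ∀ k : ℕ, Ideal.jacobson (⊥ : Ideal K) ^ k • (⊤ : Submodule K M) = ⊤ := by
    intro k
    induction k with
    | zero => simp
    | succ k ih => rw [pow_succ, Submodule.mul_smul, hjac, ih]
  have := hpow k
  rw [hk, Submodule.zero_eq_bot, Submodule.bot_smul] at this
  exact (Submodule.subsingleton_iff K).1 (subsingleton_of_bot_eq_top this)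

theorem span_eq_top_of_residue {B : Type*} [IsArtinianRing K] (w : B → M)
    (h : ∀ m : Ideal K, m.IsMaximal →
      Submodule.span (K ⧸ m) (Set.range fun i => (1 : K ⧸ m) ⊗ₜ[K] w i) = ⊤) :
    Submodule.span K (Set.range w) = ⊤ := by
  set N := Submodule.span K (Set.range w) with hN
  have : Subsingleton (M ⧸ N) := by
    refine subsingleton_of_forall_smul_eq_top (K := K) fun m hm => ?_
    have h1 : ∀ y : (K ⧸ m) ⊗[K] M, LinearMap.lTensor (K ⧸ m) N.mkQ y = 0 := by
      intro y
      have hy : y ∈ Submodule.span (K ⧸ m) (Set.range fun i => (1 : K ⧸ m) ⊗ₜ[K] w i) := by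
        rw [h m hm]; trivial
      induction hy using Submodule.span_induction with
      | mem y hy =>
        obtain ⟨i, rfl⟩ := hy
        have : N.mkQ (w i) = 0 := by
          simpa using Submodule.subset_span (R := K) (Set.mem_range_self i)
        rw [LinearMap.lTensor_tmul, this, TensorProduct.tmul_zero]
      | zero => simp
      | add y z _ _ hy hz => rw [map_add, hy, hz, add_zero]
      | smul a y _ hy =>
        have := map_smul (TensorProduct.AlgebraTensorModule.lTensor (K ⧸ m) (K ⧸ m) N.mkQ) a y
        have h2 : ∀ z, (TensorProduct.AlgebraTensorModule.lTensor (K ⧸ m) (K ⧸ m) N.mkQ) z =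
          LinearMap.lTensor (K ⧸ m) N.mkQ z := fun z => rfl
        rw [h2, h2, hy, smul_zero] at this
        exact this
    rw [eq_top_iff]
    rintro q -
    obtain ⟨x, rfl⟩ := N.mkQ_surjective q
    have h2 := h1 (1 ⊗ₜ x)
    rw [LinearMap.lTensor_tmul] at h2
    have h3 := congrArg (TensorProduct.quotTensorEquivQuotSMul (M ⧸ N) m) h2
    rw [map_zero] at h3
    have h4 : TensorProduct.quotTensorEquivQuotSMul (M ⧸ N) m ((1 : K ⧸ m) ⊗ₜ N.mkQ x) =
        Submodule.Quotient.mk (N.mkQ x) := by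
      rw [← map_one (Ideal.Quotient.mk m),
        TensorProduct.quotTensorEquivQuotSMul_mk_tmul, one_smul]
    rw [h4] at h3
    exact (Submodule.Quotient.mk_eq_zero _).1 h3
  exact Submodule.Quotient.subsingleton_iff.1 this

/-- Freeness descends along an injection `K → L` of artinian rings, with no finiteness
assumption on the module. -/
theorem nonempty_basis_of_baseChange {B : Type*} [IsArtinianRing K] [IsArtinianRing L]
    (hinj : Function.Injective (algebraMap K L)) (b : Module.Basis B L (L ⊗[K] M)) :
    Nonempty (Module.Basis B K M) := by
  let β (m : MaximalSpectrum K) :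
      Module.Basis B (K ⧸ m.asIdeal) ((K ⧸ m.asIdeal) ⊗[K] M) :=
    have := m.isMaximal
    (nonempty_basis_residue hinj b m.asIdeal).some
  obtain ⟨w, hw⟩ := exists_lift_basis_residue β
  have hspan : Submodule.span K (Set.range w) = ⊤ := by
    refine span_eq_top_of_residue w fun m hm => ?_
    have : (fun i => (1 : K ⧸ m) ⊗ₜ[K] w i) = β ⟨m, hm⟩ := funext (hw ⟨m, hm⟩)
    rw [this]
    exact (β ⟨m, hm⟩).span_eq
  have hind : LinearIndependent L (fun i => (1 : L) ⊗ₜ[K] w i) := by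
    have : Module.Free L (L ⊗[K] M) := Module.Free.of_basis b
    refine linearIndependent_of_residue _ fun n hn => ?_
    let m := n.comap (algebraMap K L)
    have hm' : m.IsPrime := Ideal.comap_isPrime _ _
    have hm : m.IsMaximal := IsArtinianRing.isMaximal_of_isPrime m
    have : n.LiesOver m := ⟨rfl⟩
    let β₁ := ((β ⟨m, hm⟩).baseChange (L ⧸ n)).map
      (TensorProduct.AlgebraTensorModule.cancelBaseChange K (K ⧸ m) (L ⧸ n) (L ⧸ n) M)
    let ψ := TensorProduct.AlgebraTensorModule.cancelBaseChange K L (L ⧸ n) (L ⧸ n) M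
    have h1 : (ψ ∘ fun i => (1 : L ⧸ n) ⊗ₜ[L] ((1 : L) ⊗ₜ[K] w i)) = β₁ := by
      funext i
      simp [ψ, β₁, ← hw ⟨m, hm⟩ i]
    refine LinearIndependent.of_comp ψ.toLinearMap ?_
    have h2 := β₁.linearIndependent
    rw [← h1] at h2
    exact h2
  have hindK : LinearIndependent K w := by
    rw [linearIndependent_iff'] at hind ⊢
    intro s a ha i hi
    apply hinj
    rw [map_zero]
    refine hind s (fun i => algebraMap K L (a i)) ?_ i hi
    have := congrArg (TensorProduct.mk K L M 1) ha
    simpa [TensorProduct.smul_tmul', Algebra.smul_def] using this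
  exact ⟨Module.Basis.mk hindK hspan.ge⟩

end Descent

/-! ### Finite-dimensional subcoalgebras and pointedness -/

section Coalgebra

variable {R D : Type*} [Field R] [Ring D] [HopfAlgebra R D]

theorem comul_lid_rTensor (f : D →ₗ[R] R) (t : D ⊗[R] D) :
    Coalgebra.comul (R := R) (TensorProduct.lid R D (f.rTensor D t)) =
      TensorProduct.lid R (D ⊗[R] D) (f.rTensor (D ⊗[R] D)
        ((Coalgebra.comul (R := R) (A := D)).lTensor D t)) := by
  induction t with
  | zero => simp
  | tmul a b => simp
  | add s t hs ht => simp only [map_add, hs, ht]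

theorem comul_rid_lTensor (f : D →ₗ[R] R) (t : D ⊗[R] D) :
    Coalgebra.comul (R := R) (TensorProduct.rid R D (f.lTensor D t)) =
      (TensorProduct.rid R D ∘ₗ f.lTensor D).lTensor D
        (TensorProduct.assoc R D D D ((Coalgebra.comul (R := R) (A := D)).rTensor D t)) := by
  have h : ∀ (s : D ⊗[R] D) (b : D), (TensorProduct.rid R D ∘ₗ f.lTensor D).lTensor D
      (TensorProduct.assoc R D D D (s ⊗ₜ b)) = f b • s := by
    intro s b
    induction s with
    | zero => simp
    | tmul x y => simp
    | add s t hs ht => simp only [TensorProduct.add_tmul, map_add, hs, ht, smul_add]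
  induction t with
  | zero => simp
  | tmul a b => simp [h]
  | add s t hs ht => simp only [map_add, hs, ht]

variable (R) in
/-- Every element of a coalgebra lies in a finite-dimensional left coideal, spanned by the
coefficients of its coproduct with respect to a basis. -/
theorem exists_leftCoideal (d : D) : ∃ C : Submodule R D, Module.Finite R C ∧ d ∈ C ∧
    ∀ c ∈ C, Coalgebra.comul (R := R) c ∈ LinearMap.range (C.subtype.lTensor D) := by
  classical
  let b := Module.Free.chooseBasis R D
  let q := TensorProduct.equivFinsuppOfBasisLeft (N := D) b (Coalgebra.comul (R := R) d)
  have hq : ∀ l, q l = TensorProduct.lid R D ((b.coord l).rTensor D (Coalgebra.comul (R := R) d)) :=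
    fun l => TensorProduct.equivFinsuppOfBasisLeft_apply b _ l
  have hd : Coalgebra.comul (R := R) d = q.sum fun l y => b l ⊗ₜ y := by
    rw [← TensorProduct.equivFinsuppOfBasisLeft_symm_apply, LinearEquiv.symm_apply_apply]
  let C := Submodule.span R (Set.range q)
  have hmem : ∀ l, q l ∈ C := fun l => Submodule.subset_span ⟨l, rfl⟩
  have hslice : ∀ (s : D ⊗[R] D) (l) (y : D), TensorProduct.lid R (D ⊗[R] D)
      ((b.coord l).rTensor (D ⊗[R] D) (TensorProduct.assoc R D D D (s ⊗ₜ y))) =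
        TensorProduct.lid R D ((b.coord l).rTensor D s) ⊗ₜ y := by
    intro s l y
    induction s with
    | zero => simp
    | tmul a c => simp [TensorProduct.smul_tmul']
    | add s t hs ht => simp only [TensorProduct.add_tmul, map_add, hs, ht]
  refine ⟨C, Module.Finite.span_of_finite R ?_, ?_, ?_⟩
  · exact q.finite_range
  · have h1 := Coalgebra.rTensor_counit_comul (R := R) d
    have h2 := congrArg (TensorProduct.lid R D) h1
    rw [TensorProduct.lid_tmul, one_smul, hd, Finsupp.sum, map_sum, map_sum] at h2
    rw [← h2]
    exact Submodule.sum_mem _ fun l _ => by simpa using C.smul_mem _ (hmem l)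
  · intro c hc
    induction hc using Submodule.span_induction with
    | zero => simp
    | add x y _ _ hx hy => rw [map_add]; exact Submodule.add_mem _ hx hy
    | smul r x _ hx => rw [map_smul]; exact Submodule.smul_mem _ r hx
    | mem c hc =>
      obtain ⟨l, rfl⟩ := hc
      rw [hq, comul_lid_rTensor, ← Coalgebra.coassoc_apply]
      conv => enter [2]; rw [hd]
      rw [Finsupp.sum, map_sum, map_sum, map_sum, map_sum]
      refine Submodule.sum_mem _ fun m _ => ?_
      rw [LinearMap.rTensor_tmul, hslice]
      exact ⟨_ ⊗ₜ ⟨q m, hmem m⟩, by rw [LinearMap.lTensor_tmul]; rfl⟩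

theorem IsSubcoalgebra.comul_mem {C : Submodule R D} (hC : IsSubcoalgebra R C) {c : D}
    (hc : c ∈ C) : Coalgebra.comul (R := R) c ∈ LinearMap.range (C.subtype.lTensor D) := by
  obtain ⟨t, ht⟩ := hC c hc
  refine ⟨C.subtype.rTensor C t, ?_⟩
  rw [← ht]
  clear ht
  induction t with
  | zero => simp
  | tmul a b => simp
  | add s t hs ht => simp only [map_add, hs, ht]

/-- In a cocommutative coalgebra, left coideals are subcoalgebras. -/
theorem isSubcoalgebra_of_leftCoideal [Coalgebra.IsCocomm R D] {C : Submodule R D}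
    (hC : ∀ c ∈ C, Coalgebra.comul (R := R) c ∈ LinearMap.range (C.subtype.lTensor D)) :
    IsSubcoalgebra R C := by
  obtain ⟨p, hp⟩ := C.subtype.exists_leftInverse_of_injective C.ker_subtype
  intro c hc
  have h1 : ∀ t ∈ LinearMap.range (C.subtype.lTensor D),
      (C.subtype ∘ₗ p).lTensor D t = t := by
    rintro _ ⟨t, rfl⟩
    rw [← LinearMap.comp_apply, ← LinearMap.lTensor_comp, LinearMap.comp_assoc, hp,
      LinearMap.comp_id]
  have h2 := h1 _ (hC c hc)
  have h3 : ∀ t : D ⊗[R] D, (C.subtype ∘ₗ p).rTensor D (TensorProduct.comm R D D t) =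
      TensorProduct.comm R D D ((C.subtype ∘ₗ p).lTensor D t) := by
    intro t
    induction t with
    | zero => simp
    | tmul a b => simp
    | add s t hs ht => simp only [map_add, hs, ht]
  have h4 := h3 (Coalgebra.comul (R := R) c)
  rw [h2, Coalgebra.comm_comul] at h4
  refine ⟨TensorProduct.map p p (Coalgebra.comul (R := R) c), ?_⟩
  have h5 : ∀ t : D ⊗[R] D, TensorProduct.mapIncl C C (TensorProduct.map p p t) =
      (C.subtype ∘ₗ p).rTensor D ((C.subtype ∘ₗ p).lTensor D t) := by
    intro t
    induction t with
    | zero => simp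
    | tmul a b => simp
    | add s t hs ht => simp only [map_add, hs, ht]
  rw [h5, h2, h4]

variable (R) in
theorem exists_finite_subcoalgebra [Coalgebra.IsCocomm R D] (d : D) :
    ∃ C : Submodule R D, Module.Finite R C ∧ d ∈ C ∧ IsSubcoalgebra R C := by
  obtain ⟨C, hfin, hd, hC⟩ := exists_leftCoideal R d
  exact ⟨C, hfin, hd, isSubcoalgebra_of_leftCoideal hC⟩

variable (R) in
/-- The matrix coalgebra of a finite-dimensional left coideal containing `d`: `d` is a combination
of elements `e i` with `Δ (e i) = ∑ t i j ⊗ e j`, where `t` is multiplicative. -/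
theorem exists_comatrix (d : D) : ∃ (r : ℕ) (e : Fin r → D) (t : Fin r → Fin r → D),
    d ∈ Submodule.span R (Set.range e) ∧
    (∀ i, Coalgebra.comul (R := R) (e i) = ∑ j, t i j ⊗ₜ e j) ∧
    (∀ i j, Coalgebra.comul (R := R) (t i j) = ∑ l, t i l ⊗ₜ t l j) ∧
    (∀ i j, Coalgebra.counit (R := R) (t i j) = if i = j then 1 else 0) := by
  classical
  obtain ⟨C, hfin, hd, hC⟩ := exists_leftCoideal R d
  obtain ⟨p, hp⟩ := C.subtype.exists_leftInverse_of_injective C.ker_subtype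
  let b := Module.finBasis R C
  have hpb : ∀ c : C, p c = c := fun c => LinearMap.congr_fun hp c
  let ξ : Fin (Module.finrank R C) → D →ₗ[R] R := fun j => b.coord j ∘ₗ p
  let e : Fin (Module.finrank R C) → D := fun i => b i
  let t : Fin (Module.finrank R C) → Fin (Module.finrank R C) → D := fun i j =>
    TensorProduct.rid R D ((ξ j).lTensor D (Coalgebra.comul (R := R) (e i)))
  have he : ∀ i, Coalgebra.comul (R := R) (e i) = ∑ j, t i j ⊗ₜ e j := by
    intro i
    have : ∀ s ∈ LinearMap.range (C.subtype.lTensor D),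
        s = ∑ j, TensorProduct.rid R D ((ξ j).lTensor D s) ⊗ₜ[R] e j := by
      rintro _ ⟨s, rfl⟩
      induction s with
      | zero => simp
      | add s t hs ht =>
        simp only [map_add, TensorProduct.add_tmul, Finset.sum_add_distrib]
        rw [← hs, ← ht]
      | tmul a c =>
        simp only [LinearMap.lTensor_tmul, Submodule.subtype_apply, TensorProduct.rid_tmul, ξ, e,
          LinearMap.comp_apply, hpb, TensorProduct.smul_tmul, ← TensorProduct.tmul_sum,
          Module.Basis.coord_apply]
        congr 1
        have := (congrArg C.subtype (b.sum_repr c)).symm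
        simp only [map_sum, map_smul, Submodule.subtype_apply] at this
        exact this
    exact this _ (hC _ (b i).2)
  refine ⟨_, e, t, ?_, he, fun i j => ?_, fun i j => ?_⟩
  · have h1 : (⟨d, hd⟩ : C) ∈ Submodule.span R (Set.range b) := by rw [b.span_eq]; trivial
    have h2 := Submodule.mem_map_of_mem (f := C.subtype) h1
    rw [Submodule.map_span, ← Set.range_comp] at h2
    exact h2
  · change Coalgebra.comul (R := R)
      (TensorProduct.rid R D ((ξ j).lTensor D (Coalgebra.comul (R := R) (e i)))) = _
    rw [comul_rid_lTensor, Coalgebra.coassoc_apply, he, map_sum, map_sum]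
    rfl
  · have h1 : ∀ s : D ⊗[R] D, Coalgebra.counit (R := R)
        (TensorProduct.rid R D ((ξ j).lTensor D s)) =
        ξ j (TensorProduct.lid R D ((Coalgebra.counit (R := R) (A := D)).rTensor D s)) := by
      intro s
      induction s with
      | zero => simp
      | tmul x y => simp [mul_comm]
      | add s t hs ht => simp only [map_add, hs, ht]
    change Coalgebra.counit (R := R)
      (TensorProduct.rid R D ((ξ j).lTensor D (Coalgebra.comul (R := R) (e i)))) = _
    rw [h1, Coalgebra.rTensor_counit_comul, TensorProduct.lid_tmul, one_smul]
    change b.coord j (p (b i)) = _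
    rw [hpb]
    simp [Finsupp.single_apply]

/-- A one-dimensional subcoalgebra is spanned by a grouplike element. -/
theorem exists_isGroupLikeElem_of_finrank_eq_one {C : Submodule R D} (hC : IsSubcoalgebra R C)
    (h1 : Module.finrank R C = 1) : ∃ g : D, IsGroupLikeElem R g ∧ C ≤ Submodule.span R {g} := by
  obtain ⟨c, hc0, hc⟩ := finrank_eq_one_iff'.1 h1
  have hc0' : (c : D) ≠ 0 := fun h => hc0 (Subtype.ext h)
  have hspan : ∀ t : C ⊗[R] C, ∃ a : R, t = a • (c ⊗ₜ[R] c) := by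
    intro t
    induction t with
    | zero => exact ⟨0, by simp⟩
    | tmul x y =>
      obtain ⟨α, rfl⟩ := hc x
      obtain ⟨β, rfl⟩ := hc y
      exact ⟨α * β, by rw [TensorProduct.smul_tmul_smul]⟩
    | add s t hs ht =>
      obtain ⟨α, rfl⟩ := hs
      obtain ⟨β, rfl⟩ := ht
      exact ⟨α + β, by rw [add_smul]⟩
  obtain ⟨t, ht⟩ := hC c c.2
  obtain ⟨a, rfl⟩ := hspan t
  have hΔ : Coalgebra.comul (R := R) (c : D) = a • ((c : D) ⊗ₜ[R] (c : D)) := by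
    rw [← ht, map_smul]
    rfl
  have h2 : (a * Coalgebra.counit (R := R) (c : D)) • (c : D) = (1 : R) • (c : D) := by
    have h3 := congrArg (TensorProduct.lid R D) (Coalgebra.rTensor_counit_comul (R := R) (c : D))
    rw [hΔ] at h3
    simpa [mul_smul] using h3
  have h4 := smul_left_injective R hc0' h2
  refine ⟨a • (c : D), ⟨by simpa using h4, ?_⟩, fun x hx => ?_⟩
  · rw [map_smul, hΔ, TensorProduct.smul_tmul_smul, smul_smul]
  · obtain ⟨α, hα⟩ := hc ⟨x, hx⟩
    have h5 : α • (c : D) = x := congrArg Subtype.val hα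
    have ha : a ≠ 0 := left_ne_zero_of_mul_eq_one h4
    refine Submodule.mem_span_singleton.2 ⟨α * a⁻¹, ?_⟩
    rw [smul_smul, mul_assoc, inv_mul_cancel₀ ha, mul_one, h5]

theorem tensor_eq_zero_of_dual {V W : Type*} [AddCommGroup V] [Module R V] [AddCommGroup W]
    [Module R W] {t : V ⊗[R] W}
    (h : ∀ f : Module.Dual R W, TensorProduct.rid R V (f.lTensor V t) = 0) : t = 0 := by
  classical
  let b := Module.Free.chooseBasis R W
  apply (TensorProduct.equivFinsuppOfBasisRight (M := V) b).injective
  ext i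
  rw [TensorProduct.equivFinsuppOfBasisRight_apply, h, map_zero, Finsupp.zero_apply]

/-- Over a pointed cocommutative coalgebra, an idempotent of a convolution algebra
`Hom_R(D, κ)` that vanishes on all grouplike elements is zero.

A finite-dimensional subcoalgebra `F` on which `ψ` vanishes is enlarged inductively. If
`E ⊂ F` is a proper nonzero subcoalgebra and `f = λ ∘ ψ` for a functional `λ`, then
`c ↦ ∑ c₍₁₎ f(c₍₂₎)` kills `E`, so its image on `F` is a smaller subcoalgebra, where `ψ` vanishes;
letting `λ` vary gives `∑ ψ(c₍₁₎) ⊗ ψ(c₍₂₎) = 0` on `F`. -/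
theorem eq_zero_of_convolution_idempotent [Coalgebra.IsCocomm R D] (hpointed : IsPointed R D)
    {κ : Type*} [CommRing κ] [Algebra R κ] (ψ : D →ₗ[R] κ)
    (hψ : ∀ d, ψ d = LinearMap.mul' R κ (TensorProduct.map ψ ψ (Coalgebra.comul (R := R) d)))
    (hg : ∀ g, IsGroupLikeElem R g → ψ g = 0) : ψ = 0 := by
  have key : ∀ (n : ℕ) (F : Submodule R D), Module.Finite R F → IsSubcoalgebra R F →
      Module.finrank R F = n → ∀ c ∈ F, ψ c = 0 := by
    intro n
    induction n using Nat.strong_induction_on with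
    | _ n ih =>
    intro F hfin hF hn c hc
    by_cases hbot : F = ⊥
    · subst hbot
      rw [(Submodule.mem_bot R).1 hc, map_zero]
    by_cases hs : IsSimpleSubcoalgebra R F
    · obtain ⟨g, hgl, hle⟩ := exists_isGroupLikeElem_of_finrank_eq_one hF (hpointed F hs)
      obtain ⟨a, rfl⟩ := Submodule.mem_span_singleton.1 (hle hc)
      rw [map_smul, hg g hgl, smul_zero]
    obtain ⟨E, hE, hEF, hE0, hE1⟩ : ∃ E, IsSubcoalgebra R E ∧ E ≤ F ∧ E ≠ ⊥ ∧ E ≠ F := by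
      by_contra! hcon
      exact hs ⟨hF, hbot, fun E hE hEF => or_iff_not_imp_left.2 fun h => hcon E hE hEF h⟩
    have hEfin : Module.Finite R E := Submodule.finiteDimensional_of_le hEF
    have hψE : ∀ x ∈ E, ψ x = 0 :=
      ih _ (hn ▸ Submodule.finrank_lt_finrank_of_lt (lt_of_le_of_ne hEF hE1)) E hEfin hE rfl
    rw [hψ]
    have : TensorProduct.map ψ ψ (Coalgebra.comul (R := R) c) = 0 := by
      apply tensor_eq_zero_of_dual
      intro l
      let f : D →ₗ[R] R := l ∘ₗ ψ
      let T : D →ₗ[R] D := TensorProduct.rid R D ∘ₗ f.lTensor D ∘ₗ Coalgebra.comul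
      have hT : ∀ (G : Submodule R D), IsSubcoalgebra R G → ∀ x ∈ G, ∃ s : G ⊗[R] G,
          T x = G.subtype (TensorProduct.rid R G ((f ∘ₗ G.subtype).lTensor G s)) := by
        intro G hG x hx
        obtain ⟨s, hs⟩ := hG x hx
        refine ⟨s, ?_⟩
        change TensorProduct.rid R D (f.lTensor D (Coalgebra.comul (R := R) x)) = _
        rw [← hs]
        clear hs
        induction s with
        | zero => simp
        | tmul a b => simp
        | add s t hs ht => simp only [map_add, hs, ht]
      have hTF : F.map T ≤ F := by
        rintro _ ⟨x, hx, rfl⟩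
        obtain ⟨s, hs⟩ := hT F hF x hx
        rw [hs]
        exact Subtype.coe_prop _
      have hTE : ∀ x ∈ E, T x = 0 := by
        intro x hx
        obtain ⟨s, hs⟩ := hT E hE x hx
        have : f ∘ₗ E.subtype = 0 := LinearMap.ext fun y => by simp [f, hψE y y.2]
        rw [hs, this]
        simp
      have hsub : IsSubcoalgebra R (F.map T) := by
        apply isSubcoalgebra_of_leftCoideal
        rintro _ ⟨x, hx, rfl⟩
        change Coalgebra.comul (R := R)
          (TensorProduct.rid R D (f.lTensor D (Coalgebra.comul (R := R) x))) ∈ _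
        rw [comul_rid_lTensor, Coalgebra.coassoc_apply]
        obtain ⟨s, hs⟩ := hF.comul_mem hx
        rw [← hs]
        clear hs
        induction s with
        | zero => simp
        | tmul a y =>
          exact ⟨a ⊗ₜ ⟨T y, Submodule.mem_map_of_mem y.2⟩, by simp [T]⟩
        | add s t hs ht => simp only [map_add]; exact Submodule.add_mem _ hs ht
      have hlt : Module.finrank R (F.map T) < n := by
        rw [← hn]
        have h1 := LinearMap.finrank_range_add_finrank_ker (T.domRestrict F)
        rw [LinearMap.range_domRestrict] at h1
        have h2 : 0 < Module.finrank R (LinearMap.ker (T.domRestrict F)) := by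
          obtain ⟨x, hx, hx0⟩ := (Submodule.ne_bot_iff E).1 hE0
          refine Nat.pos_of_ne_zero fun h' => ?_
          have h := Submodule.finrank_eq_zero.1 h'
          have : (⟨x, hEF hx⟩ : F) ∈ LinearMap.ker (T.domRestrict F) := hTE x hx
          rw [h] at this
          exact hx0 (congrArg Subtype.val ((Submodule.mem_bot R).1 this))
        omega
      have h0 : ψ (T c) = 0 :=
        ih _ hlt (F.map T) inferInstance hsub rfl _ (Submodule.mem_map_of_mem hc)
      rw [← h0]
      change _ = ψ (TensorProduct.rid R D (f.lTensor D (Coalgebra.comul (R := R) c)))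
      induction Coalgebra.comul (R := R) c with
      | zero => simp
      | tmul a b => simp [f]
      | add s t hs ht => simp only [map_add, hs, ht]
    rw [this, map_zero]
  ext d
  obtain ⟨C, hfin, hd, hC⟩ := exists_finite_subcoalgebra R d
  exact key _ C hfin hC rfl d hd

end Coalgebra

/-! ### Simplicity -/

section Simple

theorem algebraMap_injective {D K L : Type*} [Ring D] [CommRing K] [CommRing L] [Algebra K L]
    [Module D K] [Module D L] [IsDExtension D K L] [Nontrivial L] (hK : IsAS D K) :
    Function.Injective (algebraMap K L) := by
  rw [RingHom.injective_iff_ker_eq_bot]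
  refine (hK.simple (RingHom.ker (algebraMap K L)) fun d a ha => ?_).resolve_right ?_
  · rw [RingHom.mem_ker] at ha ⊢
    rw [IsDExtension.algebraMap_smul, ha, smul_zero]
  · exact RingHom.ker_ne_top _

/-- If `L` is simple and `M` is spanned over `L` by elements `h` that behave like constants,
`d (x h) = (d x) h`, then `M` has a basis of such elements: for a maximal linearly independent set
of them and any further `h`, the ideal of all `x` for which `x h` lies in its span is `D`-stable
and nonzero. -/
theorem exists_basis_of_horizontal {D L M : Type*} [Ring D] [CommRing L] [Module D L]
    [AddCommGroup M] [Module L M] (hL : IsAS D L) (act : D → M →+ M) (H : Set M)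
    (hH : ∀ h ∈ H, ∀ (d : D) (x : L), act d (x • h) = (d • x) • h)
    (hspan : Submodule.span L H = ⊤) :
    ∃ (B : Set H) (b : Module.Basis B L M), ∀ i, b i = ((i : H) : M) := by
  obtain ⟨B, hB, hmax⟩ := exists_maximal_linearIndepOn L (Subtype.val : H → M)
  have hB' : LinearIndependent L (fun i : B => ((i : H) : M)) := hB
  refine ⟨B, Module.Basis.mk hB' ?_, fun i => Module.Basis.mk_apply hB' _ i⟩
  have himg : Set.range (fun i : B => ((i : H) : M)) = Subtype.val '' B := by
    ext x; simp
  rw [← hspan, Submodule.span_le, himg]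
  intro h hh
  by_cases hi : (⟨h, hh⟩ : H) ∈ B
  · exact Submodule.subset_span ⟨_, hi, rfl⟩
  obtain ⟨a, ha0, ha⟩ := hmax ⟨h, hh⟩ hi
  set P := Submodule.span L (Subtype.val '' B : Set M) with hP
  have hact : ∀ d, ∀ y ∈ P, act d y ∈ P := by
    intro d y hy
    induction hy using Submodule.closure_induction with
    | zero => simp
    | add x y _ _ hx hy => rw [map_add]; exact P.add_mem hx hy
    | smul_mem r x hx =>
      obtain ⟨i, hi, rfl⟩ := hx
      rw [hH _ i.2]
      exact P.smul_mem _ (Submodule.subset_span ⟨i, hi, rfl⟩)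
  let I : Ideal L := P.comap (LinearMap.toSpanSingleton L M h)
  have hI : I = ⊥ ∨ I = ⊤ := by
    refine hL.simple I fun d x hx => ?_
    have := hact d _ hx
    rw [LinearMap.toSpanSingleton_apply, hH h hh] at this
    exact this
  have hI' : I = ⊤ := by
    refine hI.resolve_left fun hbot => ha0 ?_
    have : a ∈ I := ha
    rw [hbot] at this
    exact this
  have h1 : (1 : L) ∈ I := hI' ▸ Submodule.mem_top
  have h2 : (1 : L) • h ∈ P := h1
  rwa [one_smul] at h2

end Simple

/-! ### Grouplike elements act transitively on the maximal ideals -/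

section Transitive

variable {R D L : Type*} [Field R] [Ring D] [HopfAlgebra R D]
  [CommRing L] [Algebra R L] [Module D L] [IsScalarTower R D L] [IsDModuleAlgebra R D L]

/-- A grouplike element acts by a ring automorphism. -/
def groupLikeEquiv {g : D} (hg : IsGroupLikeElem R g) : L ≃+* L where
  toFun x := g • x
  invFun x := HopfAlgebra.antipode R g • x
  left_inv x := by simp only [smul_smul, hg.antipode_mul_cancel, one_smul]
  right_inv x := by simp only [smul_smul, hg.mul_antipode_cancel, one_smul]
  map_add' x y := smul_add g x y
  map_mul' x y := by
    have := IsSmashModule.smul_smul_eq (R := R) g x y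
    rwa [hg.comul_eq_tmul_self, smashAux_tmul] at this

@[simp]
theorem groupLikeEquiv_apply {g : D} (hg : IsGroupLikeElem R g) (x : L) :
    groupLikeEquiv hg x = g • x := rfl

/-- The largest `D`-stable ideal inside an ideal. -/
def stableCore (R D : Type*) {L : Type*} [Field R] [Ring D] [HopfAlgebra R D]
    [CommRing L] [Algebra R L] [Module D L] [IsScalarTower R D L] [IsDModuleAlgebra R D L]
    (n : Ideal L) : Ideal L where
  carrier := {y | ∀ d : D, d • y ∈ n}
  add_mem' hx hy d := by rw [smul_add]; exact n.add_mem (hx d) (hy d)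
  zero_mem' d := by rw [smul_zero]; exact n.zero_mem
  smul_mem' a y hy d := by
    rw [smul_smul_repr R (Coalgebra.Repr.arbitrary R d)]
    exact Ideal.sum_mem _ fun i _ => n.mul_mem_left _ (hy _)

theorem stableCore_eq_bot (hL : IsAS D L) {n : Ideal L} (hn : n ≠ ⊤) :
    stableCore R D n = ⊥ := by
  refine (hL.simple (stableCore R D n) fun d a ha c => ?_).resolve_right fun h => hn ?_
  · rw [smul_smul]; exact ha _
  · rw [Ideal.eq_top_iff_one]
    have h1 : (1 : L) ∈ stableCore R D n := h ▸ Submodule.mem_top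
    have := h1 1
    rwa [one_smul] at this

/-- An artinian ring has an idempotent that separates a maximal ideal from all others, lifted from
the quotient by the Jacobson radical. -/
theorem exists_idempotent_of_isMaximal [IsArtinianRing L] (n : Ideal L) [hn : n.IsMaximal] :
    ∃ e : L, IsIdempotentElem e ∧ e ∉ n ∧ ∀ m : Ideal L, m.IsMaximal → m ≠ n → e ∈ m := by
  classical
  have hcop : Pairwise (Function.onFun IsCoprime fun m : MaximalSpectrum L => m.asIdeal) := by
    intro m m' hne
    exact Ideal.isCoprime_of_isMaximal fun h => hne (MaximalSpectrum.ext h)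
  obtain ⟨x, hx⟩ := Ideal.exists_forall_sub_mem_ideal hcop
    (fun m => if m.asIdeal = n then (1 : L) else 0)
  have hid : x * x - x ∈ Ideal.jacobson (⊥ : Ideal L) := by
    rw [Ideal.jacobson, Submodule.mem_sInf]
    rintro m ⟨-, hm⟩
    have h := hx ⟨m, hm⟩
    have e : x * x - x = (x - 1) * x := by ring
    by_cases hmn : m = n
    · rw [if_pos hmn] at h
      rw [e]
      exact Ideal.mul_mem_right _ m h
    · rw [if_neg hmn, sub_zero] at h
      rw [e]
      exact Ideal.mul_mem_left m _ h
  obtain ⟨k, hk⟩ := IsArtinianRing.isNilpotent_jacobson_bot (R := L)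
  obtain ⟨e, he, hex⟩ := exists_isIdempotentElem_eq_of_ker_isNilpotent
    (Ideal.Quotient.mk (Ideal.jacobson (⊥ : Ideal L)))
    (fun y hy => ⟨k, by
      rw [Ideal.mk_ker] at hy
      have := Ideal.pow_mem_pow hy k
      rw [hk] at this
      exact this⟩)
    (Ideal.Quotient.mk _ x) ⟨x, rfl⟩
    (by rw [IsIdempotentElem, ← map_mul]; exact Ideal.Quotient.eq.2 hid)
  have hdiff : ∀ m : Ideal L, m.IsMaximal → e - x ∈ m := fun m hm =>
    (Submodule.mem_sInf.1 (Ideal.Quotient.eq.1 hex)) m ⟨bot_le, hm⟩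
  refine ⟨e, he, fun hen => ?_, fun m hm hmn => ?_⟩
  · have h := hx ⟨n, hn⟩
    rw [if_pos rfl] at h
    apply hn.ne_top
    rw [Ideal.eq_top_iff_one]
    have : (1 : L) = e - (e - x) - (x - 1) := by ring
    rw [this]
    exact n.sub_mem (n.sub_mem hen (hdiff n hn)) h
  · have h := hx ⟨m, hm⟩
    rw [if_neg hmn, sub_zero] at h
    have : e = (e - x) + x := by ring
    rw [this]
    exact m.add_mem (hdiff m hm) h

/-- The grouplike elements of a pointed `D` permute the maximal ideals of an AS algebra `L`
transitively. Otherwise some idempotent `e ≠ 0` of `L` has `g e ∈ n` for all grouplike `g`, and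
`d ↦ d e mod n` is a convolution idempotent vanishing on grouplike elements; so `D e ⊆ n`, against
simplicity. -/
theorem exists_groupLike_comap_eq [Coalgebra.IsCocomm R D] (hpointed : IsPointed R D)
    (hL : IsAS D L) (n n' : Ideal L) [hn : n.IsMaximal] [hn' : n'.IsMaximal] :
    ∃ (g : D) (hg : IsGroupLikeElem R g), n.comap (groupLikeEquiv hg : L ≃+* L) = n' := by
  have := hL.artinian
  by_contra! hcon
  obtain ⟨e, he, hen, hem⟩ := exists_idempotent_of_isMaximal n'
  let ψ : D →ₗ[R] L ⧸ n :=
    { toFun := fun d => Ideal.Quotient.mk n (d • e)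
      map_add' := fun c d => by rw [add_smul, map_add]
      map_smul' := fun r d => by
        rw [smul_assoc r d e, Algebra.smul_def, map_mul, RingHom.id_apply, Algebra.smul_def]
        rfl }
  have hψ : ψ = 0 := by
    apply eq_zero_of_convolution_idempotent hpointed
    · intro d
      change Ideal.Quotient.mk n (d • e) = _
      conv_lhs => rw [← he.eq, ← smul_eq_mul, IsSmashModule.smul_smul_eq (R := R)]
      induction Coalgebra.comul (R := R) d with
      | zero => simp
      | tmul a b => simp [ψ]
      | add s t hs ht => simp only [map_add, hs, ht]
    · intro g hg
      apply Ideal.Quotient.eq_zero_iff_mem.2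
      exact hem _ (Ideal.comap_isMaximal_of_equiv _) (hcon g hg)
  have h1 : e ∈ stableCore R D n := fun d =>
    Ideal.Quotient.eq_zero_iff_mem.1 (LinearMap.congr_fun hψ d)
  rw [stableCore_eq_bot hL hn.ne_top, Submodule.mem_bot] at h1
  exact hen (h1 ▸ n'.zero_mem)

end Transitive

/-! ### Localizing `D`-module subalgebras -/

section Localize

variable {R D K L : Type*} [Field R] [Ring D] [HopfAlgebra R D]
  [CommRing K] [Algebra R K]
  [CommRing L] [Algebra R L] [Module D L] [IsScalarTower R D L] [IsDModuleAlgebra R D L]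
  [Algebra K L] [IsScalarTower R K L]

include R in
variable (R) in
/-- Denominators survive the action of `D`: if `s y ∈ A` with `s ∈ A` a unit of `L`, then `d y` has
such a denominator as well, namely the determinant of the matrix `(t i j) s` for the matrix
coalgebra `t` of a left coideal containing `d`. Its inverse is the matrix `(t i j) s⁻¹`. -/
theorem exists_denominator_smul (A : DSubalgebra D K L) {y s : L} (hs : s ∈ A.carrier)
    (hu : IsUnit s) (hy : s * y ∈ A.carrier) (d : D) :
    ∃ s' ∈ A.carrier, IsUnit s' ∧ s' * (d • y) ∈ A.carrier := by
  classical
  obtain ⟨r, e, t, hd, he, ht, hε⟩ := exists_comatrix R d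
  obtain ⟨u, rfl⟩ := hu
  have hmul : ∀ (m : ℕ) (a b : Fin m → D) (c : D) (x z : L),
      Coalgebra.comul (R := R) c = ∑ j, a j ⊗ₜ b j →
      c • (x * z) = ∑ j, (a j • x) * (b j • z) := by
    intro m a b c x z h
    rw [← smul_eq_mul, IsSmashModule.smul_smul_eq (R := R), h, map_sum]
    rfl
  let T : Matrix (Fin r) (Fin r) A.toSubalgebra := fun i j => ⟨t i j • (u : L), A.smul_mem' _ _ hs⟩
  let T₁ : Matrix (Fin r) (Fin r) L := T.map A.toSubalgebra.val
  let T₂ : Matrix (Fin r) (Fin r) L := fun i j => t i j • ((u⁻¹ : Lˣ) : L)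
  have hT : T₁ * T₂ = 1 := by
    ext i j
    rw [Matrix.mul_apply]
    change ∑ l, (t i l • (u : L)) * (t l j • ((u⁻¹ : Lˣ) : L)) = _
    rw [← hmul _ _ _ _ _ _ (ht i j), Units.mul_inv, IsDModuleAlgebra.smul_one_eq (R := R), hε,
      Matrix.one_apply]
    split_ifs <;> simp
  let z : Fin r → L := fun i => e i • y
  let a : Fin r → A.toSubalgebra := fun i => ⟨e i • ((u : L) * y), A.smul_mem' _ _ hy⟩
  have hTz : T₁.mulVec z = fun i => (a i : L) := by
    ext i
    change ∑ l, (t i l • (u : L)) * (e l • y) = e i • ((u : L) * y)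
    rw [← hmul _ _ _ _ _ _ (he i)]
  have hdet : T₁.det = (T.det : L) := (RingHom.map_det A.toSubalgebra.val.toRingHom T).symm
  have hz : ∀ i, T₁.det * z i ∈ A.carrier := by
    intro i
    have h1 : T₁.adjugate.mulVec (T₁.mulVec z) = T₁.det • z := by
      rw [Matrix.mulVec_mulVec, Matrix.adjugate_mul, Matrix.smul_mulVec, Matrix.one_mulVec]
    have h2 : T₁.adjugate = T.adjugate.map A.toSubalgebra.val :=
      (RingHom.map_adjugate A.toSubalgebra.val.toRingHom T).symm
    have h3 : T₁.det * z i = ((∑ j, T.adjugate i j * a j : A.toSubalgebra) : L) := by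
      have := congrFun h1 i
      rw [hTz, h2] at this
      rw [Pi.smul_apply, smul_eq_mul] at this
      rw [← this]
      simp [Matrix.mulVec, dotProduct]
    rw [h3]
    exact Subtype.coe_prop _
  refine ⟨T₁.det, ?_, ?_, ?_⟩
  · rw [hdet]; exact Subtype.coe_prop _
  · exact IsUnit.of_mul_eq_one T₂.det (by rw [← Matrix.det_mul, hT, Matrix.det_one])
  · obtain ⟨c, rfl⟩ := (Submodule.mem_span_range_iff_exists_fun R).1 hd
    rw [Finset.sum_smul, Finset.mul_sum]
    refine A.toSubalgebra.sum_mem fun i _ => ?_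
    rw [smul_assoc (c i) (e i) y, mul_smul_comm, ← algebraMap_smul K]
    exact A.toSubalgebra.smul_mem (hz i) _

end Localize

section Localize

variable {R D K L : Type*} [Field R] [Ring D] [HopfAlgebra R D]
  [CommRing K] [Algebra R K]
  [CommRing L] [Algebra R L] [Module D L] [IsScalarTower R D L] [IsDModuleAlgebra R D L]
  [Algebra K L] [IsScalarTower R K L]

variable (R) in
/-- The `D`-module subalgebra of all fractions `a / s` in `L` with `a, s ∈ A` and `s` a unit
of `L`. -/
def fractions (A : DSubalgebra D K L) : DSubalgebra D K L where
  carrier := {y | ∃ s ∈ A.toSubalgebra, IsUnit s ∧ s * y ∈ A.toSubalgebra}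
  mul_mem' := by
    rintro x y ⟨s, hs, hsu, hsx⟩ ⟨t, ht, htu, hty⟩
    refine ⟨s * t, mul_mem hs ht, hsu.mul htu, ?_⟩
    rw [mul_mul_mul_comm]
    exact mul_mem hsx hty
  add_mem' := by
    rintro x y ⟨s, hs, hsu, hsx⟩ ⟨t, ht, htu, hty⟩
    refine ⟨s * t, mul_mem hs ht, hsu.mul htu, ?_⟩
    have : s * t * (x + y) = t * (s * x) + s * (t * y) := by ring
    rw [this]
    exact add_mem (mul_mem ht hsx) (mul_mem hs hty)
  algebraMap_mem' a := ⟨1, one_mem _, isUnit_one, by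
    rw [one_mul]; exact A.toSubalgebra.algebraMap_mem a⟩
  smul_mem' := by
    rintro d y ⟨s, hs, hsu, hsy⟩
    exact exists_denominator_smul R A hs hsu hsy d

theorem le_fractions (A : DSubalgebra D K L) : A.toSubalgebra ≤ (fractions R A).toSubalgebra :=
  fun y hy => ⟨1, one_mem _, isUnit_one, by rwa [one_mul]⟩

theorem isUnit_fractions (A : DSubalgebra D K L) (q : (fractions R A).toSubalgebra)
    (hq : IsUnit (q : L)) : IsUnit q := by
  obtain ⟨s, hs, hsu, hsq⟩ := q.2
  obtain ⟨u, hu⟩ := hq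
  have hinv : ((u⁻¹ : Lˣ) : L) ∈ (fractions R A).toSubalgebra := by
    refine ⟨s * q, hsq, hsu.mul ⟨u, hu⟩, ?_⟩
    rw [← hu, mul_assoc, Units.mul_inv, mul_one]
    exact hs
  exact IsUnit.of_mul_eq_one ⟨_, hinv⟩ (Subtype.ext (by
    change (q : L) * ((u⁻¹ : Lˣ) : L) = 1
    rw [← hu, Units.mul_inv]))

theorem isNoetherianRing_fractions (A : DSubalgebra D K L) (hA : IsNoetherianRing A.toSubalgebra) :
    IsNoetherianRing (fractions R A).toSubalgebra := by
  let _ : Algebra A.toSubalgebra (fractions R A).toSubalgebra :=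
    (Subalgebra.inclusion (le_fractions (R := R) A)).toAlgebra
  let S : Submonoid A.toSubalgebra := (IsUnit.submonoid L).comap A.toSubalgebra.val
  have hloc : IsLocalization S (fractions R A).toSubalgebra :=
    { map_units := fun s => isUnit_fractions A _ s.2
      surj := by
        rintro ⟨y, s, hs, hsu, hsy⟩
        refine ⟨(⟨s * y, hsy⟩, ⟨⟨s, hs⟩, hsu⟩), Subtype.ext ?_⟩
        exact mul_comm y s
      exists_of_eq := by
        intro a b h
        refine ⟨1, ?_⟩
        have : (a : L) = b := congrArg (fun z : (fractions R A).toSubalgebra => (z : L)) h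
        rw [Subtype.ext this] }
  exact IsLocalization.isNoetherianRing S _ hA

end Localize

/-! ### AS subalgebras of `L` -/

section InverseClosed

variable {R D K L : Type*} [Field R] [Ring D] [HopfAlgebra R D] [CommRing K]
  [CommRing L] [Algebra R L] [Module D L] [IsScalarTower R D L] [IsDModuleAlgebra R D L]
  [Algebra K L]

/-- A noetherian `D`-module subalgebra `M` of an AS algebra `L` that is closed under inverses is
AS. By prime avoidance every proper ideal of `M` lies in a maximal ideal of `L`, whence simplicity.
The contractions of the maximal ideals of `L` are conjugate under grouplike elements, and some of
them are minimal primes of `M`; so all are, and `M` has dimension zero. -/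
theorem isAS_of_inverseClosed [Coalgebra.IsCocomm R D] (hpointed : IsPointed R D)
    (hL : IsAS D L) (M : DSubalgebra D K L) (hM : IsNoetherianRing M.toSubalgebra)
    (hinv : ∀ q : M.toSubalgebra, IsUnit (q : L) → IsUnit q) : IsAS D M.toSubalgebra := by
  have := hL.artinian
  have := hL.nontrivial
  let ι : M.toSubalgebra →+* L := M.toSubalgebra.val.toRingHom
  have hι : Function.Injective ι := Subtype.val_injective
  have hproper : ∀ I : Ideal M.toSubalgebra, I ≠ ⊤ →
      ∃ n : Ideal L, n.IsMaximal ∧ I ≤ n.comap ι := by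
    intro I hI
    have h1 : (I : Set M.toSubalgebra) ⊆
        ⋃ n ∈ (Set.univ : Set (MaximalSpectrum L)), (n.asIdeal.comap ι : Set M.toSubalgebra) := by
      intro q hq
      have hq' : ¬ IsUnit (q : L) := fun h => hI (Ideal.eq_top_of_isUnit_mem I hq (hinv q h))
      obtain ⟨n, hn, hqn⟩ := exists_max_ideal_of_mem_nonunits hq'
      exact Set.mem_biUnion (Set.mem_univ (⟨n, hn⟩ : MaximalSpectrum L)) hqn
    obtain ⟨n₀⟩ : Nonempty (MaximalSpectrum L) := inferInstance
    obtain ⟨n, -, hn⟩ := (Ideal.subset_union_prime_finite Set.finite_univ n₀ n₀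
      (fun n _ _ _ => Ideal.comap_isPrime ι n.asIdeal)).1 h1
    exact ⟨n.asIdeal, n.isMaximal, hn⟩
  have hcomap : ∀ p ∈ minimalPrimes M.toSubalgebra, ∃ n : Ideal L, n.IsMaximal ∧ n.comap ι = p := by
    intro p hp
    obtain ⟨n, hn, hnp⟩ := Ideal.exists_comap_eq_of_mem_minimalPrimes_of_injective hι p hp
    exact ⟨n, IsArtinianRing.isMaximal_of_isPrime n, hnp⟩
  -- A prime below `n ∩ M` contains a minimal prime `n₁ ∩ M`, and `n = g⁻¹ n₁` for a grouplike `g`.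
  -- Applying `g` to `n₁ ∩ M ⊆ g⁻¹ n₁ ∩ M` gives `g n₁ ∩ M ⊆ n₁ ∩ M`, an equality by minimality;
  -- applying `g⁻¹` to it gives `n₁ ∩ M = n ∩ M`.
  have hmin : ∀ n : Ideal L, n.IsMaximal → ∀ p : Ideal M.toSubalgebra, p.IsPrime →
      p ≤ n.comap ι → n.comap ι ≤ p := by
    intro n hn p hp hpn
    obtain ⟨p₁, hp₁, hp₁p⟩ := Ideal.exists_minimalPrimes_le (I := ⊥) (J := p) bot_le
    obtain ⟨n₁, hn₁, rfl⟩ := hcomap p₁ hp₁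
    obtain ⟨g, hg, hgn⟩ := exists_groupLike_comap_eq hpointed hL n₁ n
    have hmem : ∀ x : L, x ∈ n ↔ g • x ∈ n₁ := by
      intro x
      rw [← hgn, Ideal.mem_comap, groupLikeEquiv_apply]
    let n₂ : Ideal L := n₁.comap ((groupLikeEquiv hg : L ≃+* L).symm : L →+* L)
    have hmem₂ : ∀ x : L, x ∈ n₂ ↔ HopfAlgebra.antipode R g • x ∈ n₁ := fun x => Iff.rfl
    have hn₂ : n₂.IsPrime := Ideal.comap_isPrime _ _
    have hle : n₂.comap ι ≤ n₁.comap ι := by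
      intro q hq
      have h1 : HopfAlgebra.antipode R g • q ∈ n₁.comap ι := (hmem₂ q).1 hq
      have h2 : HopfAlgebra.antipode R g • (q : L) ∈ n := hpn (hp₁p h1)
      rw [hmem, smul_smul, hg.mul_antipode_cancel, one_smul] at h2
      exact h2
    have hge : n₁.comap ι ≤ n₂.comap ι := hp₁.2 ⟨Ideal.comap_isPrime ι n₂, bot_le⟩ hle
    refine le_trans (fun q hq => ?_) hp₁p
    have h1 : g • q ∈ n₁.comap ι := (hmem q).1 hq
    have h2 : HopfAlgebra.antipode R g • (g • (q : L)) ∈ n₁ := hge h1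
    rw [smul_smul, hg.antipode_mul_cancel, one_smul] at h2
    exact h2
  refine ⟨?_, inferInstance, fun I hI => ?_⟩
  · -- Every prime is maximal: it lies below some `n.comap ι`, hence is equal to it.
    rw [isArtinianRing_iff_krullDimLE_zero, Ring.krullDimLE_zero_iff]
    intro p hp
    obtain ⟨I, hI, hpI⟩ := Ideal.exists_le_maximal p hp.ne_top
    obtain ⟨n, hn, hIn⟩ := hproper I hI.ne_top
    have : p = I := le_antisymm hpI (hIn.trans (hmin n hn p hp (hpI.trans hIn)))
    rwa [this]
  · by_cases htop : I = ⊤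
    · exact Or.inr htop
    left
    obtain ⟨n, hn, hIn⟩ := hproper I htop
    have h1 : ∀ x ∈ I, (x : L) ∈ stableCore R D n := fun x hx d => hIn (hI d x hx)
    rw [eq_bot_iff]
    intro x hx
    have h2 := h1 x hx
    rw [stableCore_eq_bot hL hn.ne_top] at h2
    exact (Submodule.mem_bot _).2 (Subtype.ext ((Submodule.mem_bot _).1 h2))

end InverseClosed

section Adjoin

variable {D K L : Type*} [Ring D] [CommRing K] [CommRing L] [Algebra K L] [Module D L]

theorem adjoin_eq_top_iff {S : Set L} : adjoin D K S = ⊤ ↔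
    ∀ M : DSubalgebra D K L, IsAS D M.toSubalgebra → S ⊆ M.carrier → M.toSubalgebra = ⊤ := by
  rw [adjoin, sInf_eq_top]
  constructor
  · intro h M hM hS
    exact h _ ⟨M, hM, hS, rfl⟩
  · rintro h _ ⟨M, hM, hS, rfl⟩
    exact h M hM hS

end Adjoin

/-! ### From split modules to `GL_n`-primitive matrices -/

section Split

/-- An equivariant injection of an artinian `L`-module into a power of a simple `L` becomes an
isomorphism after restriction to a suitable finite set of coordinates: a minimal set of coordinates
on which it stays injective. -/
theorem exists_bijective_coordinates {D L N Λ : Type*} [Ring D] [CommRing L] [Module D L]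
    [AddCommGroup N] [Module L N] [IsArtinian L N] (hL : IsAS D L) (act : D → N → N)
    (φ : N →ₗ[L] (Λ → L)) (hφ : Function.Injective φ)
    (hact : ∀ (d : D) (x : N), φ (act d x) = d • φ x) :
    ∃ (n : ℕ) (c : Fin n → Λ), Function.Bijective (LinearMap.funLeft L L c ∘ₗ φ) := by
  classical
  have hex : ∃ s : Finset Λ, ∀ x : N, (∀ i ∈ s, φ x i = 0) → x = 0 := by
    let S : Finset Λ → Submodule L N := fun s =>
      { carrier := {x | ∀ i ∈ s, φ x i = 0}
        add_mem' := fun hx hy i hi => by simp [hx i hi, hy i hi]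
        zero_mem' := fun i _ => by simp
        smul_mem' := fun a x hx i hi => by simp [hx i hi] }
    obtain ⟨_, ⟨s, rfl⟩, hs⟩ := IsArtinian.set_has_minimal (Set.range S) ⟨_, ⟨∅, rfl⟩⟩
    refine ⟨s, fun x hx => hφ ?_⟩
    rw [map_zero]
    funext i
    by_contra hi
    refine hs (S (insert i s)) ⟨_, rfl⟩ (lt_of_le_of_ne ?_ fun h => ?_)
    · intro y hy j hj
      exact hy j (Finset.mem_insert_of_mem hj)
    · have : x ∈ S (insert i s) := by rw [h]; exact hx
      exact hi (this i (Finset.mem_insert_self i s))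
  obtain ⟨s, hs, hmin⟩ := WellFounded.has_min (Finset.isWellFounded_ssubset (α := Λ)).wf
    {s : Finset Λ | ∀ x : N, (∀ i ∈ s, φ x i = 0) → x = 0} hex
  have hone : ∀ i ∈ s, ∃ x : N, φ x i = 1 ∧ ∀ j ∈ s, j ≠ i → φ x j = 0 := by
    intro i hi
    let I : Ideal L :=
      { carrier := {a | ∃ x : N, φ x i = a ∧ ∀ j ∈ s, j ≠ i → φ x j = 0}
        add_mem' := by
          rintro _ _ ⟨x, rfl, hx⟩ ⟨y, rfl, hy⟩
          exact ⟨x + y, by simp, fun j hj hji => by simp [hx j hj hji, hy j hj hji]⟩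
        zero_mem' := ⟨0, by simp⟩
        smul_mem' := by
          rintro a _ ⟨x, rfl, hx⟩
          exact ⟨a • x, by simp, fun j hj hji => by simp [hx j hj hji]⟩ }
    have hI : I = ⊤ := by
      refine (hL.simple I ?_).resolve_left fun hbot => ?_
      · rintro d _ ⟨x, rfl, hx⟩
        exact ⟨act d x, by simp [hact], fun j hj hji => by simp [hact, hx j hj hji]⟩
      · refine hmin (s.erase i) (fun x hx => hs x fun j hj => ?_) (Finset.erase_ssubset hi)
        have hx' : ∀ j ∈ s, j ≠ i → φ x j = 0 := fun j hj hji =>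
          hx j (Finset.mem_erase.2 ⟨hji, hj⟩)
        by_cases hji : j = i
        · subst hji
          have : φ x j ∈ I := ⟨x, rfl, hx'⟩
          rw [hbot] at this
          exact this
        · exact hx' j hj hji
    have h1 : (1 : L) ∈ I := hI ▸ Submodule.mem_top
    exact h1
  let e := s.equivFin.symm
  refine ⟨s.card, fun k => e k, ?_, ?_⟩
  · rw [← LinearMap.ker_eq_bot, LinearMap.ker_eq_bot']
    intro x hx
    refine hs x fun i hi => ?_
    have := congrFun hx (e.symm ⟨i, hi⟩)
    simpa using this
  · rw [← LinearMap.range_eq_top, eq_top_iff]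
    intro y _
    rw [← (Pi.basisFun L (Fin s.card)).sum_repr y]
    refine Submodule.sum_mem _ fun k _ => Submodule.smul_mem _ _ ?_
    obtain ⟨x, hx1, hx0⟩ := hone (e k) (e k).2
    refine ⟨x, ?_⟩
    funext l
    rw [Pi.basisFun_apply]
    by_cases hl : l = k
    · subst hl
      simpa using hx1
    · have := hx0 (e l) (e l).2 (fun h => hl (e.injective (Subtype.ext h)))
      simpa [Pi.single_eq_of_ne hl] using this

variable {R D K L V : Type*} [Field R] [Ring D] [HopfAlgebra R D] [Coalgebra.IsCocomm R D]
  [CommRing K] [Algebra R K] [Module D K] [IsScalarTower R D K]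
  [CommRing L] [Algebra R L] [Module D L] [IsScalarTower R D L]
  [IsDModuleAlgebra R D L]
  [Algebra K L] [IsScalarTower R K L] [IsDExtension D K L]
  [AddCommGroup V] [Module R V] [Module K V] [Module D V]
  [IsScalarTower R K V] [IsScalarTower R D V] [IsSmashModule R D K V]

theorem liftBaseChange_tensorAct (f : V →ₗ[K] L) (hf : ∀ (d : D) v, f (d • v) = d • f v)
    (d : D) (t : L ⊗[K] V) :
    f.liftBaseChange L (tensorAct R K L V d t) = d • f.liftBaseChange L t := by
  induction t with
  | zero => simp
  | add s t hs ht => simp only [map_add, smul_add, hs, ht]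
  | tmul x v =>
    rw [tensorAct_tmul, LinearMap.liftBaseChange_tmul, IsSmashModule.smul_smul_eq (R := R)]
    induction Coalgebra.comul (R := R) d with
    | zero => simp
    | tmul a b => simp [hf]
    | add s t hs ht => simp only [map_add, hs, ht]

/-- If a finitely generated `K # D`-module `V` splits in `L`, then the values of a fundamental
system of solutions `V → L` on a `K`-basis of `V` form a `GL_n`-primitive matrix, and all values of
solutions are `K`-combinations of its entries: the coefficients relating any solution to the
fundamental system are constants, hence in `K`. -/
theorem exists_glPrimitive [Module.Finite K V] (hK : IsAS D K) (hL : IsAS D L)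
    (hconst : SameConstants R D K L) {Λ : Type*} (φ : L ⊗[K] V →ₗ[L] (Λ → L))
    (hφ : Function.Injective φ)
    (hact : ∀ (d : D) (x : L ⊗[K] V), φ (tensorAct R K L V d x) = d • φ x) :
    ∃ (n : ℕ) (X : Matrix.GeneralLinearGroup (Fin n) L), IsGLPrimitive D K X ∧
      solutionSet D K L V ⊆
        Algebra.adjoin K (Set.range fun p : Fin n × Fin n => X p.1 p.2) := by
  classical
  have := hK.artinian
  have := hL.artinian
  have := hL.nontrivial
  obtain ⟨n, c, hc⟩ := exists_bijective_coordinates hL (fun d => tensorAct R K L V d) φ hφ hact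
  let ψ := LinearEquiv.ofBijective _ hc
  have hψ : ∀ t i, ψ t i = φ t (c i) := fun t i => rfl
  obtain ⟨v⟩ := nonempty_basis_of_baseChange (algebraMap_injective hK) (Module.Basis.ofEquivFun ψ)
  -- The coordinates of `ψ` restrict to solutions `F i : V → L`.
  let F : Fin n → V →ₗ[K] L := fun i =>
    (LinearMap.proj (c i) ∘ₗ φ).restrictScalars K ∘ₗ TensorProduct.mk K L V 1
  have hF : ∀ i x, F i x = ψ (1 ⊗ₜ x) i := fun i x => rfl
  have hFd : ∀ i (d : D) x, F i (d • x) = d • F i x := by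
    intro i d x
    rw [hF, hψ, ← tensorAct_one_tmul (R := R) d x, hact]
    rfl
  let X₀ : Matrix (Fin n) (Fin n) L := fun j i => F i (v j)
  have hX₀ : IsUnit X₀.det := by
    have h1 := LinearEquiv.isUnit_det ψ (v.baseChange L) (Pi.basisFun L (Fin n))
    rw [← Matrix.det_transpose] at h1
    convert h1 using 2
    ext j i
    simp [X₀, hF, LinearMap.toMatrix_apply]
  let X : Matrix.GeneralLinearGroup (Fin n) L := Matrix.GeneralLinearGroup.mk'' X₀ hX₀
  have hX : ∀ j i, X j i = F i (v j) := fun j i => rfl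
  refine ⟨n, X, fun d => ⟨fun j l => v.repr (d • v j) l, ?_⟩, ?_⟩
  · have h1 : (X : Matrix (Fin n) (Fin n) L).map (fun x => d • x) =
        Matrix.map (fun j l => v.repr (d • v j) l) (algebraMap K L) *
          (X : Matrix (Fin n) (Fin n) L) := by
      ext j i
      rw [Matrix.map_apply, hX, ← hFd, Matrix.mul_apply]
      conv_lhs => rw [← v.sum_repr (d • v j)]
      rw [map_sum]
      refine Finset.sum_congr rfl fun l _ => ?_
      rw [map_smul, Algebra.smul_def]
      rfl
    rw [h1, mul_assoc, ← Units.val_mul, mul_inv_cancel, Units.val_one, mul_one]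
  · rintro _ ⟨f, hf, x, rfl⟩
    -- The dual basis `t` of `L ⊗_K V` consists of constants, so a solution takes constant values on it.
    let t : Fin n → L ⊗[K] V := fun i => ψ.symm (Pi.single i 1)
    have ht : ∀ i (d : D), tensorAct R K L V d (t i) = Coalgebra.counit (R := R) d • t i := by
      intro i d
      apply ψ.injective
      rw [← algebraMap_smul L, map_smul, algebraMap_smul]
      funext k
      rw [hψ, hact, Pi.smul_apply, ← hψ, Pi.smul_apply]
      simp only [t, LinearEquiv.apply_symm_apply]
      by_cases hk : k = i
      · subst hk
        simp [IsDModuleAlgebra.smul_one_eq (R := R)]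
      · simp [Pi.single_eq_of_ne hk]
    have hk : ∀ i, ∃ k : K, algebraMap K L k = f.liftBaseChange L (t i) := by
      intro i
      have : f.liftBaseChange L (t i) ∈ constants R D L := by
        intro d
        rw [← liftBaseChange_tensorAct (R := R) f hf, ht, ← algebraMap_smul L, map_smul,
          algebraMap_smul]
      rw [← hconst] at this
      obtain ⟨k, -, hk⟩ := this
      exact ⟨k, hk⟩
    choose k hk using hk
    have hfx : f x = ∑ i, algebraMap K L (k i) * F i x := by
      have h1 : (1 : L) ⊗ₜ[K] x = ∑ i, F i x • t i := by
        apply ψ.injective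
        rw [map_sum]
        simp only [map_smul, t, LinearEquiv.apply_symm_apply]
        funext l
        rw [← hF]
        simp [Pi.single_apply]
      have h2 : f x = f.liftBaseChange L ((1 : L) ⊗ₜ[K] x) := by simp
      rw [h2, h1, map_sum]
      refine Finset.sum_congr rfl fun i _ => ?_
      rw [map_smul, ← hk, smul_eq_mul, mul_comm]
    rw [hfx]
    refine Subalgebra.sum_mem _ fun i _ => Subalgebra.mul_mem _ (Subalgebra.algebraMap_mem _ _) ?_
    rw [← v.sum_repr x, map_sum]
    refine Subalgebra.sum_mem _ fun j _ => ?_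
    rw [map_smul]
    exact Subalgebra.smul_mem _ (Algebra.subset_adjoin
      (Set.mem_range_self (f := fun p : Fin n × Fin n => X p.1 p.2) (j, i))) _

end Split

/-! ### `K # D`-submodules -/

section DSubmodule

theorem IsSmashModule.of_injective {R D K V W : Type*} [Field R] [Ring D] [HopfAlgebra R D]
    [CommRing K] [Algebra R K] [Module D K] [IsScalarTower R D K]
    [AddCommGroup V] [Module R V] [Module K V] [Module D V] [IsScalarTower R K V]
    [IsScalarTower R D V]
    [AddCommGroup W] [Module R W] [Module K W] [Module D W] [IsScalarTower R K W]
    [IsScalarTower R D W] [IsSmashModule R D K W] (f : V →ₗ[K] W) (hinj : Function.Injective f)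
    (hf : ∀ (d : D) v, f (d • v) = d • f v) : IsSmashModule R D K V where
  smul_smul_eq d a v := by
    have h : ∀ t : D ⊗[R] D, f (smashAux R D a v t) = smashAux R D a (f v) t := by
      intro t
      induction t with
      | zero => simp
      | tmul b c => simp [hf]
      | add s t hs ht => simp only [map_add, hs, ht]
    apply hinj
    rw [h, ← IsSmashModule.smul_smul_eq, hf, map_smul]

/-- `K`-submodules of `W` that are stable under `D`. -/
structure DSubmodule (D K W : Type*) [Ring D] [CommRing K] [AddCommGroup W] [Module K W]
    [Module D W] extends Submodule K W where
  smul_mem_of_mem : ∀ (d : D), ∀ w ∈ carrier, d • w ∈ carrier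

variable {R D K W : Type*} [Field R] [Ring D] [HopfAlgebra R D]
  [CommRing K] [Algebra R K] [Module D K] [IsScalarTower R D K]
  [AddCommGroup W] [Module R W] [Module K W] [Module D W] [IsScalarTower R K W]
  [IsScalarTower R D W] (V : DSubmodule D K W)

instance : Module D V.toSubmodule where
  smul d w := ⟨d • (w : W), V.smul_mem_of_mem d w w.2⟩
  one_smul w := Subtype.ext (one_smul D (w : W))
  mul_smul c d w := Subtype.ext (mul_smul c d (w : W))
  smul_zero d := Subtype.ext (smul_zero d)
  smul_add d w w' := Subtype.ext (smul_add d (w : W) w')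
  add_smul c d w := Subtype.ext (add_smul c d (w : W))
  zero_smul w := Subtype.ext (zero_smul D (w : W))

instance : IsScalarTower R D V.toSubmodule where
  smul_assoc r d w := Subtype.ext (smul_assoc r d (w : W))

instance [IsSmashModule R D K W] : IsSmashModule R D K V.toSubmodule :=
  IsSmashModule.of_injective V.toSubmodule.subtype V.toSubmodule.injective_subtype
    fun _ _ => rfl

variable (R D K) in
/-- The `K # D`-submodule generated by a set. -/
def DSubmodule.span [IsSmashModule R D K W] (S : Set W) : DSubmodule D K W where
  toSubmodule := Submodule.span K {x | ∃ (d : D), ∃ w ∈ S, d • w = x}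
  smul_mem_of_mem := by
    intro d x hx
    change x ∈ Submodule.span K _ at hx
    change d • x ∈ Submodule.span K _
    induction hx using Submodule.closure_induction with
    | zero => simp
    | add x y _ _ hx hy => rw [smul_add]; exact Submodule.add_mem _ hx hy
    | smul_mem a x hx =>
      obtain ⟨c, w, hw, rfl⟩ := hx
      rw [smul_smul_repr R (Coalgebra.Repr.arbitrary R d)]
      refine Submodule.sum_mem _ fun i _ => Submodule.smul_mem _ _ ?_
      rw [smul_smul]
      exact Submodule.subset_span ⟨_, w, hw, rfl⟩

theorem DSubmodule.subset_span [IsSmashModule R D K W] (S : Set W) :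
    S ⊆ (DSubmodule.span R D K S).carrier :=
  fun w hw => Submodule.subset_span ⟨1, w, hw, one_smul D w⟩

end DSubmodule

/-! ### Picard-Vessiot extensions -/

section PV

variable {R D K L : Type*} [Field R] [Ring D] [HopfAlgebra R D] [Coalgebra.IsCocomm R D]
  [CommRing K] [Algebra R K] [Module D K] [IsScalarTower R D K]
  [CommRing L] [Algebra R L] [Module D L] [IsScalarTower R D L]
  [IsDModuleAlgebra R D L]
  [Algebra K L] [IsScalarTower R K L] [IsDExtension D K L]

/-- If constants generate `A ⊗_K A` over `A`, then `L ⊗_K A` is free over `L` with a basis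
consisting of constants. -/
theorem exists_basis_constants (hL : IsAS D L) (A : DSubalgebra D K L)
    (hA : Submodule.span A.toSubalgebra (tensorConstants R A) = ⊤) :
    ∃ (B : Set (L ⊗[K] A.toSubalgebra)) (b : Module.Basis B L (L ⊗[K] A.toSubalgebra)),
      ∀ (d : D) (i : B), tensorAct R K L A.toSubalgebra d (b i) =
        Coalgebra.counit (R := R) d • b i := by
  let H : Set (L ⊗[K] A.toSubalgebra) :=
    {h | ∀ d : D, tensorAct R K L A.toSubalgebra d h = Coalgebra.counit (R := R) d • h}
  let j : A.toSubalgebra ⊗[K] A.toSubalgebra →ₗ[K] L ⊗[K] A.toSubalgebra :=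
    TensorProduct.map A.toSubalgebra.val.toLinearMap LinearMap.id
  have hjH : ∀ h ∈ tensorConstants R A, j h ∈ H := by
    intro h hh d
    rw [tensorAct_map _ _ (fun _ _ => rfl) (fun _ _ => rfl), hh d, ← algebraMap_smul K, map_smul,
      algebraMap_smul]
  have hjsmul : ∀ (a : A.toSubalgebra) t, j (a • t) = (a : L) • j t := by
    intro a t
    induction t with
    | zero => simp
    | tmul x y => simp [j, TensorProduct.smul_tmul']
    | add s t hs ht => simp only [smul_add, map_add, hs, ht]
  have hspan : Submodule.span L H = ⊤ := by
    rw [eq_top_iff]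
    rintro t -
    induction t with
    | zero => exact Submodule.zero_mem _
    | add s t hs ht => exact Submodule.add_mem _ hs ht
    | tmul l a =>
      have h1 : ∀ t ∈ Submodule.span A.toSubalgebra (tensorConstants R A),
          j t ∈ Submodule.span L H := by
        intro t ht
        induction ht using Submodule.span_induction with
        | mem t ht => exact Submodule.subset_span (hjH t ht)
        | zero => simp
        | add x y _ _ hx hy => rw [map_add]; exact Submodule.add_mem _ hx hy
        | smul a x _ hx => rw [hjsmul]; exact Submodule.smul_mem _ _ hx
      have h2 : j (1 ⊗ₜ a) ∈ Submodule.span L H := h1 _ (hA ▸ Submodule.mem_top)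
      have h3 : l ⊗ₜ[K] a = l • j (1 ⊗ₜ a) := by
        simp [j, TensorProduct.smul_tmul']
      rw [h3]
      exact Submodule.smul_mem _ _ h2
  obtain ⟨B, b, hb⟩ := exists_basis_of_horizontal hL
    (fun d => tensorAct R K L A.toSubalgebra d) H
    (fun h hh d x => tensorAct_smul_of_const hh d x) hspan
  let e : B ≃ (Subtype.val '' B : Set (L ⊗[K] A.toSubalgebra)) :=
    Equiv.Set.image Subtype.val B Subtype.val_injective
  refine ⟨_, b.reindex e, fun d i => ?_⟩
  rw [Module.Basis.reindex_apply, hb]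
  exact (e.symm i).1.2 d

/-- Coordinates with respect to a basis of constants are `D`-linear. -/
theorem repr_tensorAct_of_const {W B : Type*}
    [AddCommGroup W] [Module R W] [Module K W] [Module D W] [IsScalarTower R K W]
    [IsScalarTower R D W] [IsSmashModule R D K W] (b : Module.Basis B L (L ⊗[K] W))
    (hb : ∀ (d : D) (i : B), tensorAct R K L W d (b i) = Coalgebra.counit (R := R) d • b i)
    (d : D) (t : L ⊗[K] W) (i : B) :
    b.repr (tensorAct R K L W d t) i = d • b.repr t i := by
  have h : tensorAct R K L W d t = ∑ i ∈ (b.repr t).support, (d • b.repr t i) • b i := by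
    conv_lhs => rw [← b.linearCombination_repr t, Finsupp.linearCombination_apply, Finsupp.sum]
    rw [map_sum]
    exact Finset.sum_congr rfl fun i _ => tensorAct_smul_of_const (fun d => hb d i) d _
  rw [h, map_sum, Finsupp.finsetSum_apply]
  simp only [map_smul, Finsupp.smul_apply, Module.Basis.repr_self, smul_eq_mul]
  classical
  by_cases hi : i ∈ (b.repr t).support
  · rw [Finset.sum_eq_single_of_mem i hi]
    · simp
    · intro k _ hki
      simp [hki]
  · rw [Finsupp.notMem_support_iff.1 hi, smul_zero]
    refine Finset.sum_eq_zero fun k hk => ?_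
    have : k ≠ i := fun h => hi (h ▸ hk)
    simp [this]

/-- A Picard-Vessiot extension is faithfully flat: `A` is free over `K` by descent from
`L ⊗_K A`, and `L` is a localization of `A`. -/
theorem faithfullyFlat_of_pv (hK : IsAS D K) (hL : IsAS D L) (A : DSubalgebra D K L)
    (hfrac : IsFractionRing A.toSubalgebra L)
    (hA : Submodule.span A.toSubalgebra (tensorConstants R A) = ⊤) :
    Module.FaithfullyFlat K L := by
  have := hK.artinian
  have := hL.artinian
  have := hL.nontrivial
  obtain ⟨B, b, -⟩ := exists_basis_constants hL A hA
  obtain ⟨b'⟩ := nonempty_basis_of_baseChange (algebraMap_injective hK) b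
  have : Module.Free K A.toSubalgebra := Module.Free.of_basis b'
  have : Module.Flat A.toSubalgebra L :=
    IsLocalization.flat L (nonZeroDivisors A.toSubalgebra)
  have hflat : Module.Flat K L := Module.Flat.trans K A.toSubalgebra L
  refine ⟨fun m hm h => ?_⟩
  obtain ⟨n, hn, hnm⟩ := exists_isPrime_comap_eq (algebraMap_injective (L := L) hK) m
  apply hn.ne_top
  rw [Ideal.eq_top_iff_one]
  have h1 : (1 : L) ∈ m • (⊤ : Submodule K L) := by rw [h]; trivial
  have h2 : ∀ x ∈ m • (⊤ : Submodule K L), x ∈ n := by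
    intro x hx
    induction hx using Submodule.smul_induction_on' with
    | smul a ha y _ =>
      rw [Algebra.smul_def]
      refine Ideal.mul_mem_right _ _ ?_
      rw [← hnm] at ha
      exact ha
    | add x _ y _ hx hy => exact n.add_mem hx hy
  exact h2 1 h1

/-- Every `t ∈ L ⊗_K W` comes from `L ⊗_K N` for some finitely generated `N ⊆ W`, stated as vanishing
in `L ⊗_K (W ⧸ N')` for all `N' ⊇ N`. -/
theorem exists_fg_baseChange_mkQ_eq_zero {W : Type*} [AddCommGroup W] [Module K W]
    (t : L ⊗[K] W) : ∃ N : Submodule K W, N.FG ∧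
      ∀ N' : Submodule K W, N ≤ N' → N'.mkQ.baseChange L t = 0 := by
  induction t with
  | zero => exact ⟨⊥, Submodule.fg_bot, fun _ _ => map_zero _⟩
  | tmul l w =>
    refine ⟨Submodule.span K {w}, Submodule.fg_span_singleton w, fun N' h => ?_⟩
    have : N'.mkQ w = 0 := by
      simpa using h (Submodule.mem_span_singleton_self w)
    rw [LinearMap.baseChange_tmul, this, TensorProduct.tmul_zero]
  | add s t hs ht =>
    obtain ⟨N₁, h₁, h₁'⟩ := hs
    obtain ⟨N₂, h₂, h₂'⟩ := ht
    exact ⟨N₁ ⊔ N₂, h₁.sup h₂, fun N' h => by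
      rw [map_add, h₁' N' (le_sup_left.trans h), h₂' N' (le_sup_right.trans h), add_zero]⟩

/-- `D` acts locally finitely on `A` if `L ⊗_K A` has an `L`-basis of constants: writing
`1 ⊗ a = ∑ lⱼ hⱼ` with constants `hⱼ` gives `1 ⊗ d a = ∑ (d lⱼ) hⱼ`. -/
theorem exists_fg_smul_mem [Module.FaithfullyFlat K L] {W B : Type*}
    [AddCommGroup W] [Module R W] [Module K W] [Module D W] [IsScalarTower R K W]
    [IsScalarTower R D W] [IsSmashModule R D K W] (b : Module.Basis B L (L ⊗[K] W))
    (hb : ∀ (d : D) (i : B), tensorAct R K L W d (b i) = Coalgebra.counit (R := R) d • b i)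
    (w : W) : ∃ N : Submodule K W, N.FG ∧ ∀ d : D, d • w ∈ N := by
  choose N hN hN' using fun i => exists_fg_baseChange_mkQ_eq_zero (K := K) (b i)
  let c := b.repr ((1 : L) ⊗ₜ[K] w)
  refine ⟨c.support.sup N, Submodule.fg_finset_sup _ _ fun i _ => hN i, fun d => ?_⟩
  set N₀ := c.support.sup N with hN₀
  have h1 : (1 : L) ⊗ₜ[K] (d • w) = ∑ i ∈ c.support, (d • c i) • b i := by
    rw [← tensorAct_one_tmul (R := R)]
    conv_lhs => rw [← b.linearCombination_repr ((1 : L) ⊗ₜ[K] w), Finsupp.linearCombination_apply,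
      Finsupp.sum]
    rw [map_sum]
    exact Finset.sum_congr rfl fun i _ => tensorAct_smul_of_const (fun d => hb d i) d _
  have h2 : N₀.mkQ.baseChange L ((1 : L) ⊗ₜ[K] (d • w)) = 0 := by
    rw [h1, map_sum]
    refine Finset.sum_eq_zero fun i hi => ?_
    rw [map_smul, hN' i N₀ (Finset.le_sup hi), smul_zero]
  rw [LinearMap.baseChange_tmul] at h2
  have h3 : N₀.mkQ (d • w) = 0 :=
    Module.FaithfullyFlat.tensorProduct_mk_injective (A := K) (B := L) (W ⧸ N₀)
      (by rw [map_zero]; exact h2)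
  simpa using h3

/-- A finitely generated Picard-Vessiot extension is generated by the `GL_n`-primitive matrix of the
`K # D`-submodule of `A` spanned by numerators and denominators of the generators. -/
theorem exists_glPrimitive_of_pv (hK : IsAS D K) (hL : IsAS D L)
    (hconst : SameConstants R D K L) (hPV : IsPVExtension R D K L)
    (hfg : IsFinitelyGenerated D K L) :
    ∃ (n : ℕ) (X : Matrix.GeneralLinearGroup (Fin n) L), IsGLPrimitive D K X ∧
      adjoin D K (Set.range fun p : Fin n × Fin n => X p.1 p.2) = ⊤ := by
  classical
  obtain ⟨-, A, hfrac, hA⟩ := hPV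
  obtain ⟨S, hS⟩ := hfg
  have := hK.artinian
  have hff := faithfullyFlat_of_pv hK hL A hfrac hA
  obtain ⟨B, b, hb⟩ := exists_basis_constants hL A hA
  choose q hq using fun u : L => IsLocalization.surj (nonZeroDivisors A.toSubalgebra) u
  let S' : Finset A.toSubalgebra :=
    S.image (fun u => (q u).1) ∪ S.image (fun u => ((q u).2 : A.toSubalgebra))
  let V : DSubmodule D K A.toSubalgebra := DSubmodule.span R D K (S' : Set A.toSubalgebra)
  -- The `K # D`-submodule generated by the numerators and denominators is finite over `K`.
  choose N hN hdN using fun a : A.toSubalgebra => exists_fg_smul_mem b hb a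
  have hVN : V.toSubmodule ≤ S'.sup N := by
    refine Submodule.span_le.2 ?_
    rintro _ ⟨d, a, ha, rfl⟩
    exact (Finset.le_sup ha : N a ≤ S'.sup N) (hdN a d)
  have hNfg : (S'.sup N).FG := Submodule.fg_finset_sup _ _ fun i _ => hN i
  have hVfin : Module.Finite K V.toSubmodule := by
    have : IsNoetherian K (S'.sup N : Submodule K A.toSubalgebra) :=
      isNoetherian_of_fg_of_noetherian _ hNfg
    exact Module.Finite.of_injective (Submodule.inclusion hVN) (Submodule.inclusion_injective hVN)
  let ψ : L ⊗[K] V.toSubmodule →ₗ[L] L ⊗[K] A.toSubalgebra := V.toSubmodule.subtype.baseChange L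
  have hψ : Function.Injective ψ :=
    Module.Flat.lTensor_preserves_injective_linearMap _ V.toSubmodule.injective_subtype
  have hψD : ∀ (d : D) t, ψ (tensorAct R K L V.toSubmodule d t) =
      tensorAct R K L A.toSubalgebra d (ψ t) := fun d t =>
    (tensorAct_map (LinearMap.id : L →ₗ[K] L) V.toSubmodule.subtype
      (fun _ _ => rfl) (fun _ _ => rfl) d t).symm
  obtain ⟨n, X, hX, hsol⟩ := exists_glPrimitive (R := R) (V := V.toSubmodule) hK hL hconst
    (Finsupp.lcoeFun ∘ₗ b.repr.toLinearMap ∘ₗ ψ)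
    (DFunLike.coe_injective.comp (b.repr.injective.comp hψ))
    (fun d t => by
      funext i
      change b.repr (ψ _) i = d • b.repr (ψ t) i
      rw [hψD, repr_tensorAct_of_const b hb])
  refine ⟨n, X, hX, adjoin_eq_top_iff.2 fun M hM hXM => ?_⟩
  have := hM.artinian
  have hS'M : ∀ a ∈ S', (a : L) ∈ M.toSubalgebra := by
    intro a ha
    refine Algebra.adjoin_le (S := M.toSubalgebra) hXM (hsol ?_)
    exact ⟨A.toSubalgebra.val.toLinearMap ∘ₗ V.toSubmodule.subtype, fun _ _ => rfl,
      ⟨a, DSubmodule.subset_span _ ha⟩, rfl⟩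
  refine adjoin_eq_top_iff.1 hS M hM fun u hu => ?_
  have hnum := hS'M (q u).1 (Finset.mem_union_left _ (Finset.mem_image_of_mem _ hu))
  have hden := hS'M (q u).2 (Finset.mem_union_right _ (Finset.mem_image_of_mem _ hu))
  -- The denominator is a non-zero-divisor, hence a unit, of the artinian ring `M`.
  have hunitL : IsUnit ((q u).2 : L) := IsLocalization.map_units L (q u).2
  have hunit : IsUnit (⟨_, hden⟩ : M.toSubalgebra) := by
    refine IsArtinianRing.isUnit_of_mem_nonZeroDivisors (mem_nonZeroDivisors_of_injective
      (f := M.toSubalgebra.val) Subtype.val_injective hunitL.mem_nonZeroDivisors)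
  obtain ⟨w, hw⟩ := hunit.exists_right_inv
  have hw' : ((q u).2 : L) * (w : L) = 1 := congrArg Subtype.val hw
  have hu' : u = ((q u).1 : L) * w := by
    have h := hq u
    change u * ((q u).2 : L) = ((q u).1 : L) at h
    rw [← h, mul_assoc, hw', mul_one]
  change u ∈ M.toSubalgebra
  rw [hu']
  exact M.toSubalgebra.mul_mem hnum w.2

end PV

/-! ### Extensions generated by a `GL_n`-primitive matrix -/

section Antipode

variable {R D L : Type*} [Field R] [Ring D] [HopfAlgebra R D] [Coalgebra.IsCocomm R D]

theorem rightComm_rTensor_comul (d : D) :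
    TensorProduct.rightComm R D D D
        ((Coalgebra.comul (R := R) (A := D)).rTensor D (Coalgebra.comul (R := R) d)) =
      (Coalgebra.comul (R := R) (A := D)).rTensor D (Coalgebra.comul (R := R) d) := by
  apply (TensorProduct.assoc R D D D).injective
  have h1 : ∀ t : (D ⊗[R] D) ⊗[R] D, TensorProduct.assoc R D D D
      (TensorProduct.rightComm R D D D t) =
      (TensorProduct.comm R D D).toLinearMap.lTensor D (TensorProduct.assoc R D D D t) := by
    intro t
    induction t with
    | zero => simp
    | add s t hs ht => simp only [map_add, hs, ht]
    | tmul s z =>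
      induction s with
      | zero => simp
      | add s t hs ht => simp only [TensorProduct.add_tmul, map_add, hs, ht]
      | tmul x y => simp
  rw [h1, Coalgebra.coassoc_apply]
  induction Coalgebra.comul (R := R) d with
  | zero => simp
  | add s t hs ht => simp only [map_add, hs, ht]
  | tmul x y => simp

variable [CommRing L] [Algebra R L] [Module D L] [IsScalarTower R D L] [IsDModuleAlgebra R D L]

/-- `x (d y) = ∑ d₍₁₎ ((S(d₍₂₎) x) y)`, the general form of `x (g y) = g ((g⁻¹ x) y)` for
grouplike `g`. -/
theorem sum_smul_antipode_smul_mul {ι : Type*} {d : D} (r : Coalgebra.Repr R d ι) (x y : L) :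
    ∑ i ∈ r.index, r.left i • ((HopfAlgebra.antipode R (r.right i) • x) * y) = x * (d • y) := by
  let ev : L → D →ₗ[R] L := fun z => (LinearMap.toSpanSingleton D L z).restrictScalars R
  have hev : ∀ z c, ev z c = c • z := fun z c => rfl
  let m : D ⊗[R] D →ₗ[R] L :=
    ev x ∘ₗ LinearMap.mul' R D ∘ₗ (HopfAlgebra.antipode R (A := D)).lTensor D
  let T : (D ⊗[R] D) ⊗[R] D →ₗ[R] L := LinearMap.mul' R L ∘ₗ TensorProduct.map m (ev y)
  have h1 : ∀ a c : D, a • ((HopfAlgebra.antipode R c • x) * y) =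
      T (TensorProduct.rightComm R D D D (Coalgebra.comul (R := R) a ⊗ₜ c)) := by
    intro a c
    rw [← smul_eq_mul (HopfAlgebra.antipode R c • x) y, IsSmashModule.smul_smul_eq (R := R)]
    induction Coalgebra.comul (R := R) a with
    | zero => simp
    | add s t hs ht => simp only [TensorProduct.add_tmul, map_add, hs, ht]
    | tmul b e => simp [T, m, hev, mul_smul]
  have h2 : ∀ a c : D, T (Coalgebra.comul (R := R) a ⊗ₜ c) =
      (Coalgebra.counit (R := R) a • x) * (c • y) := by
    intro a c
    simp [T, m, hev, HopfAlgebra.mul_antipode_lTensor_comul_apply, Algebra.algebraMap_eq_smul_one]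
  calc ∑ i ∈ r.index, r.left i • ((HopfAlgebra.antipode R (r.right i) • x) * y)
      = T (TensorProduct.rightComm R D D D
        ((Coalgebra.comul (R := R) (A := D)).rTensor D (Coalgebra.comul (R := R) d))) := by
        rw [← r.eq]
        simp only [map_sum, LinearMap.rTensor_tmul, h1]
    _ = ∑ i ∈ r.index, (Coalgebra.counit (R := R) (r.left i) • x) * (r.right i • y) := by
        rw [rightComm_rTensor_comul, ← r.eq]
        simp only [map_sum, LinearMap.rTensor_tmul, h2]
    _ = x * (d • y) := by
        conv_rhs => rw [← Coalgebra.sum_counit_smul r, Finset.sum_smul, Finset.mul_sum]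
        refine Finset.sum_congr rfl fun i _ => ?_
        rw [smul_assoc, smul_mul_assoc, mul_smul_comm (Coalgebra.counit (R := R) (r.left i))]

variable {K : Type*} [CommRing K] [Module D K] [Algebra K L] [IsDExtension D K L]

include R in
/-- If `d X = C(d) X` then `d X⁻¹ = X⁻¹ E(d)`, where `E(d) = ∑ d₍₁₎ C(S d₍₂₎)`. -/
theorem exists_smul_inverse {n : Type*} [Fintype n] [DecidableEq n] {x y : Matrix n n L}
    (hxy : x * y = 1) {C : D → Matrix n n K}
    (hC : ∀ d, x.map (fun a => d • a) = (C d).map (algebraMap K L) * x) (d : D) :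
    ∃ E : Matrix n n K, y.map (fun a => d • a) = y * E.map (algebraMap K L) := by
  let r := Coalgebra.Repr.arbitrary R d
  let E : Matrix n n K := ∑ k ∈ r.index,
    (C (HopfAlgebra.antipode R (r.right k))).map (fun a => r.left k • a)
  have hE : x * y.map (fun a => d • a) = E.map (algebraMap K L) := by
    ext i j
    have h1 : ∀ c : D, ∑ l, (c • x i l) * y l j = algebraMap K L (C c i j) := by
      intro c
      have h : x.map (fun a => c • a) * y = (C c).map (algebraMap K L) := by
        rw [hC, mul_assoc, hxy, mul_one]
      have := congrFun (congrFun h i) j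
      rwa [Matrix.mul_apply] at this
    rw [Matrix.mul_apply, Matrix.map_apply, show E i j = _ from Matrix.sum_apply i j _ _, map_sum]
    simp only [Matrix.map_apply]
    calc ∑ l, x i l * (d • y l j)
        = ∑ l, ∑ k ∈ r.index,
          r.left k • ((HopfAlgebra.antipode R (r.right k) • x i l) * y l j) :=
        Finset.sum_congr rfl fun l _ => (sum_smul_antipode_smul_mul r _ _).symm
      _ = _ := by
        rw [Finset.sum_comm]
        refine Finset.sum_congr rfl fun k _ => ?_
        rw [← Finset.smul_sum, h1, IsDExtension.algebraMap_smul]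
  refine ⟨E, ?_⟩
  rw [← hE, ← mul_assoc, mul_eq_one_comm.1 hxy, one_mul]

end Antipode

section Constants

variable {R D K B : Type*} [Field R] [Ring D] [HopfAlgebra R D] [Coalgebra.IsCocomm R D]
  [CommRing K] [Algebra R K] [Module D K] [IsScalarTower R D K]
  [CommRing B] [Algebra R B] [Module D B] [IsScalarTower R D B] [Algebra K B]
  [IsScalarTower R K B] [IsDModuleAlgebra R D B] [IsSmashModule R D K B]

/-- The entries of `X⁻¹ ⊗ X` are constants if `d X = C(d) X` with `C(d)` over `K`. -/
theorem tensorAct_sum_inverse_tmul {n : Type*} [Fintype n] [DecidableEq n] {x y : Matrix n n B}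
    (hyx : y * x = 1) {C : D → Matrix n n K}
    (hC : ∀ d, x.map (fun a => d • a) = (C d).map (algebraMap K B) * x) (i j : n) (d : D) :
    tensorAct R K B B d (∑ l, y i l ⊗ₜ[K] x l j) =
      Coalgebra.counit (R := R) d • ∑ l, y i l ⊗ₜ[K] x l j := by
  let r := Coalgebra.Repr.arbitrary R d
  have hC' : ∀ d l j, d • x l j = ∑ m, C d l m • x m j := by
    intro d l j
    have := congrFun (congrFun (hC d) l) j
    simpa [Matrix.mul_apply, Algebra.smul_def] using this
  let T : Matrix n n B := fun i m => ∑ k ∈ r.index, ∑ l, C (r.right k) l m • (r.left k • y i l)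
  have hT : T = Coalgebra.counit (R := R) d • y := by
    have h : T * x = Coalgebra.counit (R := R) d • (1 : Matrix n n B) := by
      ext i j
      have h1 : d • (y * x) i j = Coalgebra.counit (R := R) d • (1 : Matrix n n B) i j := by
        rw [hyx, Matrix.one_apply]
        split_ifs
        · exact IsDModuleAlgebra.smul_one_eq d
        · simp
      rw [Matrix.smul_apply, ← h1, Matrix.mul_apply, Matrix.mul_apply, Finset.smul_sum]
      simp only [smul_mul_repr R r, hC', T, Finset.sum_mul, Finset.mul_sum]
      rw [Finset.sum_comm]
      conv_rhs => rw [Finset.sum_comm]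
      refine Finset.sum_congr rfl fun k _ => ?_
      rw [Finset.sum_comm]
      refine Finset.sum_congr rfl fun l _ => Finset.sum_congr rfl fun m _ => ?_
      rw [smul_mul_assoc, mul_smul_comm]
    calc T = T * x * y := by rw [mul_assoc, mul_eq_one_comm.1 hyx, mul_one]
      _ = _ := by rw [h, smul_mul_assoc, one_mul]
  calc tensorAct R K B B d (∑ l, y i l ⊗ₜ[K] x l j)
      = ∑ m, T i m ⊗ₜ[K] x m j := by
        simp only [map_sum, tensorAct_tmul_repr r, hC', T, TensorProduct.tmul_sum,
          TensorProduct.sum_tmul]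
        rw [Finset.sum_comm]
        conv_rhs => rw [Finset.sum_comm]
        refine Finset.sum_congr rfl fun k _ => ?_
        rw [Finset.sum_comm]
        refine Finset.sum_congr rfl fun l _ => Finset.sum_congr rfl fun m _ => ?_
        rw [TensorProduct.tmul_smul, TensorProduct.smul_tmul']
    _ = _ := by
        rw [hT, Finset.smul_sum]
        rfl

end Constants

section Primitive

variable {R D K L : Type*} [Field R] [Ring D] [HopfAlgebra R D]
  [CommRing K]
  [CommRing L] [Algebra R L] [Module D L] [IsScalarTower R D L]
  [IsDModuleAlgebra R D L] [Algebra K L]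

section

variable [Module D K] [IsDExtension D K L]

include R in
theorem smul_mem_algebraAdjoin {S : Set L}
    (hS : ∀ (d : D), ∀ s ∈ S, d • s ∈ Algebra.adjoin K S) (d : D) {a : L}
    (ha : a ∈ Algebra.adjoin K S) : d • a ∈ Algebra.adjoin K S := by
  induction ha using Algebra.adjoin_induction generalizing d with
  | mem s hs => exact hS d s hs
  | algebraMap c =>
    rw [← IsDExtension.algebraMap_smul]
    exact Subalgebra.algebraMap_mem _ _
  | add x y _ _ hx hy => rw [smul_add]; exact add_mem (hx d) (hy d)
  | mul x y _ _ hx hy =>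
    rw [smul_mul_repr R (Coalgebra.Repr.arbitrary R d)]
    exact sum_mem fun i _ => mul_mem (hx _) (hy _)

end

variable [Algebra R K] [IsScalarTower R K L]

theorem isFractionRing_of_fractions_eq_top (hL : IsAS D L) (A : DSubalgebra D K L)
    (hA : (fractions R A).toSubalgebra = ⊤) : IsFractionRing A.toSubalgebra L := by
  have := hL.artinian
  have hfrac : ∀ y : L, ∃ s ∈ A.toSubalgebra, IsUnit s ∧ s * y ∈ A.toSubalgebra := fun y =>
    (hA ▸ Algebra.mem_top : y ∈ (fractions R A).toSubalgebra)
  have hunit : ∀ s : A.toSubalgebra, s ∈ nonZeroDivisors A.toSubalgebra ↔ IsUnit (s : L) := by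
    intro s
    constructor
    · intro hs
      refine IsArtinianRing.isUnit_of_mem_nonZeroDivisors ?_
      rw [mem_nonZeroDivisors_iff_right]
      intro y hy
      obtain ⟨t, ht, htu, hty⟩ := hfrac y
      have h : (⟨t * y, hty⟩ : A.toSubalgebra) * s = 0 :=
        Subtype.ext (by change t * y * s = 0; rw [mul_assoc, hy, mul_zero])
      have h' := congrArg Subtype.val ((mem_nonZeroDivisors_iff_right.1 hs) _ h)
      exact (htu.mul_right_eq_zero).1 h'
    · intro hs
      exact mem_nonZeroDivisors_of_injective (f := A.toSubalgebra.val) Subtype.val_injective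
        hs.mem_nonZeroDivisors
  exact
    { map_units := fun s => (hunit s).1 s.2
      surj := fun y => by
        obtain ⟨s, hs, hsu, hsy⟩ := hfrac y
        refine ⟨(⟨s * y, hsy⟩, ⟨⟨s, hs⟩, (hunit _).2 hsu⟩), ?_⟩
        exact mul_comm y s
      exists_of_eq := fun {x y} h => ⟨1, by rw [Subtype.ext h]⟩ }

variable [Coalgebra.IsCocomm R D] [Module D K] [IsScalarTower R D K]
  [IsDExtension D K L]

variable (R) in
/-- Constants of `A ⊗_K A` form a multiplicative submonoid. -/
def constantSubmonoid (A : DSubalgebra D K L) :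
    Submonoid (A.toSubalgebra ⊗[K] A.toSubalgebra) where
  carrier := tensorConstants R A
  one_mem' d := by
    rw [Algebra.TensorProduct.one_def, tensorAct_one_tmul,
      IsDModuleAlgebra.smul_one_eq (R := R), TensorProduct.tmul_smul]
  mul_mem' {s t} hs ht d := by
    rw [tensorAct_mul_of_const ht, hs d, smul_mul_assoc]

/-- `A ⊗_K A` is generated by constants over `A` as soon as `1 ⊗ s` is in the `A`-algebra
generated by the constants for all `s` in a set of algebra generators of `A`. -/
theorem span_tensorConstants_eq_top (A : DSubalgebra D K L) (S : Set L)
    (hSA : A.toSubalgebra = Algebra.adjoin K S)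
    (hS : ∀ s : A.toSubalgebra, (s : L) ∈ S →
      (1 : A.toSubalgebra) ⊗ₜ[K] s ∈ Submodule.span A.toSubalgebra (tensorConstants R A)) :
    Submodule.span A.toSubalgebra (tensorConstants R A) = ⊤ := by
  let P := Algebra.adjoin A.toSubalgebra (tensorConstants R A)
  have hP : Subalgebra.toSubmodule P =
      Submodule.span A.toSubalgebra (tensorConstants R A) := by
    rw [Algebra.adjoin_eq_span]
    congr 1
    exact congrArg (SetLike.coe) (Submonoid.closure_eq (constantSubmonoid R A))
  have h1 : ∀ (x : L) (hx : x ∈ Algebra.adjoin K S) (hx' : x ∈ A.toSubalgebra),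
      (1 : A.toSubalgebra) ⊗ₜ[K] (⟨x, hx'⟩ : A.toSubalgebra) ∈ P := by
    intro x hx
    induction hx using Algebra.adjoin_induction with
    | mem s hs =>
      intro hx'
      have := hS ⟨s, hx'⟩ hs
      rw [← hP] at this
      exact this
    | algebraMap c =>
      intro hx'
      have : (1 : A.toSubalgebra) ⊗ₜ[K] (⟨algebraMap K L c, hx'⟩ : A.toSubalgebra) =
          algebraMap A.toSubalgebra (A.toSubalgebra ⊗[K] A.toSubalgebra)
            (algebraMap K A.toSubalgebra c) := by
        have : (⟨algebraMap K L c, hx'⟩ : A.toSubalgebra) = c • 1 :=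
          Subtype.ext (Algebra.algebraMap_eq_smul_one c)
        rw [this, TensorProduct.tmul_smul, TensorProduct.smul_tmul',
          Algebra.TensorProduct.algebraMap_apply, ← Algebra.algebraMap_eq_smul_one]
        rfl
      rw [this]
      exact P.algebraMap_mem _
    | add x y hx hy ihx ihy =>
      intro hx'
      rw [← hSA] at hx hy
      have : (⟨x + y, hx'⟩ : A.toSubalgebra) = ⟨x, hx⟩ + ⟨y, hy⟩ := rfl
      rw [this, TensorProduct.tmul_add]
      exact P.add_mem (ihx hx) (ihy hy)
    | mul x y hx hy ihx ihy =>
      intro hx'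
      rw [← hSA] at hx hy
      have : (1 : A.toSubalgebra) ⊗ₜ[K] (⟨x * y, hx'⟩ : A.toSubalgebra) =
          ((1 : A.toSubalgebra) ⊗ₜ[K] (⟨x, hx⟩ : A.toSubalgebra)) * (1 ⊗ₜ[K] ⟨y, hy⟩) := by
        rw [Algebra.TensorProduct.tmul_mul_tmul, one_mul]
        rfl
      rw [this]
      exact P.mul_mem (ihx hx) (ihy hy)
  rw [← hP, eq_top_iff]
  rintro t -
  change t ∈ P
  induction t with
  | zero => exact P.zero_mem
  | add s t hs ht => exact P.add_mem hs ht
  | tmul a b =>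
    have : a ⊗ₜ[K] b = a • ((1 : A.toSubalgebra) ⊗ₜ[K] b) := by
      rw [TensorProduct.smul_tmul', smul_eq_mul, mul_one]
    rw [this]
    exact P.smul_mem (h1 b (hSA ▸ b.2) b.2) a

/-- If `L = K⟨X⟩` with `X` a `GL_n`-primitive matrix, then `L/K` is a Picard-Vessiot extension with
`A = K[X, X⁻¹]`: `A ⊗_K A` is generated over `A ⊗ 1` by the entries of the constant matrix
`X⁻¹ ⊗ X` and of its inverse. -/
theorem isPVExtension_of_glPrimitive (hpointed : IsPointed R D) (hK : IsAS D K) (hL : IsAS D L)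
    (hconst : SameConstants R D K L) {n : ℕ} (X : Matrix.GeneralLinearGroup (Fin n) L)
    (hX : IsGLPrimitive D K X)
    (hgen : adjoin D K (Set.range fun p : Fin n × Fin n => X p.1 p.2) = ⊤) :
    IsPVExtension R D K L := by
  classical
  have := hK.artinian
  let x : Matrix (Fin n) (Fin n) L := X
  let y : Matrix (Fin n) (Fin n) L := (X⁻¹ : Matrix.GeneralLinearGroup (Fin n) L)
  have hxy : x * y = 1 := Units.mul_inv X
  have hyx : y * x = 1 := Units.inv_mul X
  choose C hC' using hX
  have hC : ∀ d, x.map (fun a => d • a) = (C d).map (algebraMap K L) * x := by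
    intro d
    rw [← hC' d]
    change _ = _ * y * x
    rw [mul_assoc, hyx, mul_one]
  let S : Set L := (Set.range fun p : Fin n × Fin n => x p.1 p.2) ∪
    Set.range fun p : Fin n × Fin n => y p.1 p.2
  have hSfin : S.Finite := (Set.finite_range _).union (Set.finite_range _)
  have hxS : ∀ i j, x i j ∈ Algebra.adjoin K S := fun i j =>
    Algebra.subset_adjoin (Or.inl ⟨(i, j), rfl⟩)
  have hyS : ∀ i j, y i j ∈ Algebra.adjoin K S := fun i j =>
    Algebra.subset_adjoin (Or.inr ⟨(i, j), rfl⟩)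
  obtain ⟨A, hAS⟩ : ∃ A : DSubalgebra D K L, A.toSubalgebra = Algebra.adjoin K S := ⟨
    { Algebra.adjoin K S with
      smul_mem' := by
        intro d a ha
        refine smul_mem_algebraAdjoin (R := R) ?_ d ha
        rintro d _ (⟨⟨i, j⟩, rfl⟩ | ⟨⟨i, j⟩, rfl⟩)
        · have h := congrFun (congrFun (hC d) i) j
          rw [Matrix.map_apply, Matrix.mul_apply] at h
          change d • x i j ∈ _
          rw [h]
          exact sum_mem fun l _ => mul_mem (Subalgebra.algebraMap_mem _ _) (hxS _ _)
        · obtain ⟨E, hE⟩ := exists_smul_inverse (R := R) hxy hC d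
          have h := congrFun (congrFun hE i) j
          rw [Matrix.map_apply, Matrix.mul_apply] at h
          change d • y i j ∈ _
          rw [h]
          exact sum_mem fun l _ => mul_mem (hyS _ _) (Subalgebra.algebraMap_mem _ _) },
    rfl⟩
  rw [← hAS] at hxS hyS
  have hnoeth : IsNoetherianRing A.toSubalgebra :=
    isNoetherianRing_of_fg ⟨hSfin.toFinset, by rw [hSfin.coe_toFinset, hAS]⟩
  have htop : (fractions R A).toSubalgebra = ⊤ := by
    refine adjoin_eq_top_iff.1 hgen _ (isAS_of_inverseClosed hpointed hL _
      (isNoetherianRing_fractions A hnoeth) (isUnit_fractions A)) ?_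
    rintro _ ⟨⟨i, j⟩, rfl⟩
    exact le_fractions A (hxS i j)
  refine ⟨hconst, A, isFractionRing_of_fractions_eq_top hL A htop, ?_⟩
  let x' : Matrix (Fin n) (Fin n) A.toSubalgebra := fun i j => ⟨x i j, hxS i j⟩
  let y' : Matrix (Fin n) (Fin n) A.toSubalgebra := fun i j => ⟨y i j, hyS i j⟩
  have hval : ∀ u w : Matrix (Fin n) (Fin n) A.toSubalgebra,
      u.map A.toSubalgebra.val = w.map A.toSubalgebra.val → u = w := fun u w h =>
    Matrix.map_injective Subtype.val_injective h
  have hyx' : y' * x' = 1 := hval _ _ (by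
    rw [Matrix.map_mul, Matrix.map_one _ (map_zero _) (map_one _)]
    exact hyx)
  have hxy' : x' * y' = 1 := mul_eq_one_comm.1 hyx'
  have hCA : ∀ d, x'.map (fun a => d • a) = (C d).map (algebraMap K A.toSubalgebra) * x' :=
    fun d => hval _ _ (by rw [Matrix.map_mul]; exact hC d)
  have hZ : ∀ i j, ∑ l, y' i l ⊗ₜ[K] x' l j ∈ tensorConstants R A := fun i j d =>
    tensorAct_sum_inverse_tmul hyx' hCA i j d
  have hZ' : ∀ i j, ∑ l, x' l j ⊗ₜ[K] y' i l ∈ tensorConstants R A := by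
    intro i j d
    have h := congrArg (TensorProduct.comm K _ _) (hZ i j d)
    rw [← tensorAct_comm, ← algebraMap_smul K (Coalgebra.counit (R := R) d), map_smul,
      algebraMap_smul] at h
    simpa only [map_sum, TensorProduct.comm_tmul] using h
  refine span_tensorConstants_eq_top A S hAS ?_
  rintro ⟨_, hs⟩ (⟨⟨i, j⟩, rfl⟩ | ⟨⟨i, j⟩, rfl⟩)
  · -- `1 ⊗ X = (X ⊗ 1) (X⁻¹ ⊗ X)`
    have h : (1 : A.toSubalgebra) ⊗ₜ[K] x' i j =
        ∑ m, x' i m • ∑ l, y' m l ⊗ₜ[K] x' l j := by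
      simp only [Finset.smul_sum, TensorProduct.smul_tmul', smul_eq_mul]
      rw [Finset.sum_comm]
      simp only [← TensorProduct.sum_tmul, ← Matrix.mul_apply, hxy', Matrix.one_apply]
      rw [Finset.sum_eq_single_of_mem i (Finset.mem_univ _)]
      · simp
      · intro l _ hl
        simp [hl.symm]
    change (1 : A.toSubalgebra) ⊗ₜ[K] x' i j ∈ _
    rw [h]
    exact Submodule.sum_mem _ fun m _ =>
      Submodule.smul_mem _ _ (Submodule.subset_span (hZ m j))
  · -- `1 ⊗ X⁻¹ = (X ⊗ X⁻¹) (X⁻¹ ⊗ 1)`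
    have h : (1 : A.toSubalgebra) ⊗ₜ[K] y' i j =
        ∑ m, y' m j • ∑ l, x' l m ⊗ₜ[K] y' i l := by
      simp only [Finset.smul_sum, TensorProduct.smul_tmul', smul_eq_mul]
      rw [Finset.sum_comm]
      simp only [mul_comm (y' _ j), ← TensorProduct.sum_tmul, ← Matrix.mul_apply, hxy',
        Matrix.one_apply]
      rw [Finset.sum_eq_single_of_mem j (Finset.mem_univ _)]
      · simp
      · intro l _ hl
        simp [hl]
    change (1 : A.toSubalgebra) ⊗ₜ[K] y' i j ∈ _
    rw [h]
    exact Submodule.sum_mem _ fun m _ =>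
      Submodule.smul_mem _ _ (Submodule.subset_span (hZ' i m))

end Primitive

/-! ### Cyclic splitting modules -/

section

variable {K L V W ι : Type*} [CommRing K] [CommRing L] [Algebra K L] [AddCommGroup V] [Module K V]
  [AddCommGroup W] [Module K W] [Module L W] [IsScalarTower K L W]

/-- If `L` is flat over `K` and `V` embeds `K`-linearly into the `K`-span of an `L`-linearly
independent family of an `L`-module, then `L ⊗_K V` embeds as well. -/
theorem liftBaseChange_injective [Module.Flat K L] (hKL : Function.Injective (algebraMap K L))
    (f : V →ₗ[K] W) (hf : Function.Injective f) {e : ι → W} (he : LinearIndependent L e)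
    (hfe : ∀ v, f v ∈ Submodule.span K (Set.range e)) :
    Function.Injective (f.liftBaseChange L) := by
  have he' : LinearIndependent K e := he.restrict_scalars (by
    simpa only [← Algebra.algebraMap_eq_smul_one] using hKL)
  let b := Module.Basis.span he'
  let f' : V →ₗ[K] Submodule.span K (Set.range e) := f.codRestrict _ hfe
  have hf' : Function.Injective (f'.baseChange L) :=
    Module.Flat.lTensor_preserves_injective_linearMap f' fun v w h =>
      hf (congrArg Subtype.val h)
  let g := (Submodule.span K (Set.range e)).subtype.liftBaseChange L
  have hg : g = Finsupp.linearCombination L e ∘ₗ (b.baseChange L).repr.toLinearMap := by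
    refine (b.baseChange L).ext fun i => ?_
    rw [LinearMap.comp_apply, LinearEquiv.coe_coe, Module.Basis.repr_self,
      Finsupp.linearCombination_single, one_smul]
    simp [g, b, Module.Basis.baseChange_apply, Module.Basis.span_apply]
  have hg' : Function.Injective g := by
    have he'' : Function.Injective (Finsupp.linearCombination L e) := he
    rw [hg]
    exact he''.comp (b.baseChange L).repr.injective
  have h : f.liftBaseChange L = g ∘ₗ f'.baseChange L := by
    ext v
    simp [g, f']
  rw [h]
  exact hg'.comp hf'

theorem liftBaseChange_apply (f : V →ₗ[K] (ι → L)) (t : L ⊗[K] V) (i : ι) :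
    f.liftBaseChange L t i = (LinearMap.proj i ∘ₗ f).liftBaseChange L t := by
  induction t with
  | zero => simp
  | tmul l v => simp
  | add s t hs ht => simp only [map_add, Pi.add_apply, hs, ht]

end

section

variable {R D K L : Type*} [Field R] [Ring D] [HopfAlgebra R D]
  [CommRing K] [Algebra R K] [Module D K] [IsScalarTower R D K]
  [CommRing L] [Algebra R L] [Module D L] [IsScalarTower R D L]
  [IsDModuleAlgebra R D L]
  [Algebra K L] [IsScalarTower R K L] [IsDExtension D K L]

instance (ι : Type*) : IsSmashModule R D K (ι → L) where
  smul_smul_eq d a v := by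
    funext i
    have h : ∀ t : D ⊗[R] D, smashAux R D a v t i = smashAux R D a (v i) t := by
      intro t
      induction t with
      | zero => simp
      | tmul b c => simp
      | add s t hs ht => simp only [map_add, Pi.add_apply, hs, ht]
    rw [h, ← IsSmashModule.smul_smul_eq]
    rfl

end

/-- A `K # D`-module of finite `K`-rank has an isomorphic copy in the universe of `K`. -/
theorem exists_small_copy {R D : Type*} {K : Type u} {W : Type*}
    [Field R] [Ring D] [HopfAlgebra R D]
    [CommRing K] [Algebra R K] [Module D K] [IsScalarTower R D K]
    [AddCommGroup W] [Module R W] [Module K W] [Module D W] [IsScalarTower R K W]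
    [IsScalarTower R D W] [IsSmashModule R D K W] (V' : DSubmodule D K W)
    [Module.Finite K V'.toSubmodule] :
    ∃ (V : Type u) (_ : AddCommGroup V) (_ : Module R V) (_ : Module K V) (_ : Module D V)
      (_ : IsScalarTower R K V) (_ : IsScalarTower R D V) (_ : IsSmashModule R D K V)
      (f : V →ₗ[K] W), Module.Finite K V ∧ Function.Injective f ∧
        (∀ (d : D) v, f (d • v) = d • f v) ∧ LinearMap.range f = V'.toSubmodule := by
  obtain ⟨m, g, hg⟩ := Module.Finite.exists_fin' K V'.toSubmodule
  have : Small.{u} V'.toSubmodule := small_of_surjective hg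
  let eK := Shrink.linearEquiv.{u} K V'.toSubmodule
  let eR := Shrink.linearEquiv.{u} R V'.toSubmodule
  let eD := Shrink.linearEquiv.{u} D V'.toSubmodule
  have heR : ∀ (r : R) v, eK (r • v) = r • eK v := fun r v => eR.map_smul r v
  have heD : ∀ (d : D) v, eK (d • v) = d • eK v := fun d v => eD.map_smul d v
  have h1 : IsScalarTower R K (Shrink.{u} V'.toSubmodule) :=
    ⟨fun r a v => eK.injective (by rw [heR, map_smul, map_smul, smul_assoc])⟩
  have h2 : IsScalarTower R D (Shrink.{u} V'.toSubmodule) :=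
    ⟨fun r d v => eK.injective (by rw [heR, heD, heD, smul_assoc])⟩
  have h3 : IsSmashModule R D K (Shrink.{u} V'.toSubmodule) :=
    IsSmashModule.of_injective eK.toLinearMap eK.injective heD
  refine ⟨Shrink.{u} V'.toSubmodule, inferInstance, inferInstance, inferInstance, inferInstance,
    h1, h2, h3, V'.toSubmodule.subtype ∘ₗ eK.toLinearMap, Module.Finite.equiv eK.symm,
    V'.toSubmodule.injective_subtype.comp eK.injective,
    fun d v => congrArg Subtype.val (heD d v), ?_⟩
  rw [LinearMap.range_comp, LinearEquiv.range, Submodule.map_top, Submodule.range_subtype]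

/-- If `L = K⟨X⟩` with `X` a `GL_n`-primitive matrix and `L` flat over `K`, then `L/K` is a minimal
splitting algebra for a copy of the `K # D`-module generated by `X` inside `M_n(L)`: it is contained
in the `K`-space `M_n(K) X`, and its entries are solutions. -/
theorem exists_cyclic_of_glPrimitive {R D : Type*} {K : Type u} {L : Type v}
    [Field R] [Ring D] [HopfAlgebra R D] [Coalgebra.IsCocomm R D]
    [CommRing K] [Algebra R K] [Module D K] [IsScalarTower R D K]
    [CommRing L] [Algebra R L] [Module D L] [IsScalarTower R D L] [IsDModuleAlgebra R D L]
    [Algebra K L] [IsScalarTower R K L] [IsDExtension D K L] [IsNoetherianRing K]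
    [Module.Flat K L] (hKL : Function.Injective (algebraMap K L)) {n : ℕ}
    (X : Matrix.GeneralLinearGroup (Fin n) L) (hX : IsGLPrimitive D K X)
    (hgen : adjoin D K (Set.range fun p : Fin n × Fin n => X p.1 p.2) = ⊤) :
    ∃ (V : Type u) (_ : AddCommGroup V) (_ : Module R V) (_ : Module K V) (_ : Module D V)
      (_ : IsScalarTower R K V) (_ : IsScalarTower R D V) (_ : IsSmashModule R D K V),
      IsCyclicModule D K V ∧ Module.Finite K V ∧ IsMinimalSplittingAlgebra R D K L V := by
  classical
  let x : Matrix (Fin n) (Fin n) L := X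
  let y : Matrix (Fin n) (Fin n) L := (X⁻¹ : Matrix.GeneralLinearGroup (Fin n) L)
  have hxy : x * y = 1 := Units.mul_inv X
  have hyx : y * x = 1 := Units.inv_mul X
  choose C hC' using hX
  have hC : ∀ d, x.map (fun a => d • a) = (C d).map (algebraMap K L) * x := by
    intro d
    rw [← hC' d]
    change _ = _ * y * x
    rw [mul_assoc, hyx, mul_one]
  let w : Fin n × Fin n → L := fun p => x p.1 p.2
  -- `e (i, l)` is the matrix `E_{il} X`.
  let e : Fin n × Fin n → (Fin n × Fin n → L) := fun q p => if p.1 = q.1 then x q.2 p.2 else 0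
  have hsum : ∀ (c : Matrix (Fin n) (Fin n) L) (p : Fin n × Fin n),
      (∑ q : Fin n × Fin n, c q.1 q.2 • e q) p = (c * x) p.1 p.2 := by
    intro c p
    rw [Fintype.sum_prod_type, Finset.sum_apply, Finset.sum_eq_single_of_mem p.1
      (Finset.mem_univ _)]
    · simp [e, Matrix.mul_apply]
    · intro i _ hi
      simp [e, hi.symm]
  have he : LinearIndependent L e := by
    rw [Fintype.linearIndependent_iff]
    intro c hc q
    let c' : Matrix (Fin n) (Fin n) L := fun i l => c (i, l)
    have h : c' * x = 0 := by
      ext i j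
      rw [← hsum c' (i, j)]
      exact congrFun hc (i, j)
    have h' : c' = 0 := by
      calc c' = c' * x * y := by rw [mul_assoc, hxy, mul_one]
        _ = 0 := by rw [h, zero_mul]
    exact congrFun (congrFun h' q.1) q.2
  let V' : DSubmodule D K (Fin n × Fin n → L) := DSubmodule.span R D K {w}
  have hV'e : V'.toSubmodule ≤ Submodule.span K (Set.range e) := by
    refine Submodule.span_le.2 ?_
    rintro _ ⟨d, _, rfl, rfl⟩
    have h : d • w = ∑ q : Fin n × Fin n, C d q.1 q.2 • e q := by
      funext p
      have h1 := congrFun (congrFun (hC d) p.1) p.2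
      rw [← hsum] at h1
      simp only [Matrix.map_apply, algebraMap_smul] at h1
      exact h1
    rw [h]
    exact Submodule.sum_mem _ fun q _ => Submodule.smul_mem _ _
      (Submodule.subset_span (Set.mem_range_self q))
  have hV'fin : Module.Finite K V'.toSubmodule := by
    have : IsNoetherian K (Submodule.span K (Set.range e)) :=
      isNoetherian_of_fg_of_noetherian _ (Submodule.fg_span (Set.finite_range e))
    exact Module.Finite.of_injective (Submodule.inclusion hV'e) (Submodule.inclusion_injective hV'e)
  obtain ⟨V, i₁, i₂, i₃, i₄, i₅, i₆, i₇, f, hfin, hf, hfD, hfr⟩ := exists_small_copy (R := R) V'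
  have hw : w ∈ LinearMap.range f := by
    rw [hfr]
    exact DSubmodule.subset_span _ rfl
  obtain ⟨v, hv⟩ := hw
  have hsol : ∀ p (d : D) v, (LinearMap.proj p ∘ₗ f : V →ₗ[K] L) (d • v) =
      d • (LinearMap.proj p ∘ₗ f : V →ₗ[K] L) v := fun p d v => congrFun (hfD d v) p
  refine ⟨V, i₁, i₂, i₃, i₄, i₅, i₆, i₇, ⟨v, ?_⟩, hfin,
    ⟨ULift (Fin n × Fin n), LinearMap.funLeft L L ULift.down ∘ₗ f.liftBaseChange L, ?_, ?_⟩, ?_⟩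
  · apply Submodule.map_injective_of_injective hf
    rw [Submodule.map_span, Submodule.map_top, hfr]
    change _ = Submodule.span K _
    congr 1
    ext z
    simp [← hv, hfD]
  · refine (LinearMap.funLeft_injective_of_surjective L L _ ULift.down_surjective).comp
      (liftBaseChange_injective hKL f hf he fun v => hV'e ?_)
    rw [← hfr]
    exact LinearMap.mem_range_self f v
  · intro d t
    funext p
    change f.liftBaseChange L _ p.down = d • f.liftBaseChange L t p.down
    rw [liftBaseChange_apply, liftBaseChange_apply, liftBaseChange_tensorAct _ (hsol p.down)]
  · refine adjoin_eq_top_iff.2 fun M hM hVM => adjoin_eq_top_iff.1 hgen M hM ?_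
    rintro _ ⟨p, rfl⟩
    exact hVM ⟨_, hsol p, v, congrFun hv p⟩

end PicardVessiot

theorem mainTheorem2 {R : Type*} {D : Type*} {K : Type u} {L : Type v}
    [Field R] [Ring D] [HopfAlgebra R D] [Coalgebra.IsCocomm R D]
    (hpointed : PicardVessiot.IsPointed R D) (hBW : PicardVessiot.IsBirkhoffWittType R D)
    [CommRing K] [Algebra R K] [Module D K] [IsScalarTower R D K]
    [PicardVessiot.IsDModuleAlgebra R D K]
    [CommRing L] [Algebra R L] [Module D L] [IsScalarTower R D L]
    [PicardVessiot.IsDModuleAlgebra R D L]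
    [Algebra K L] [IsScalarTower R K L] [PicardVessiot.IsDExtension D K L]
    (hK : PicardVessiot.IsAS D K) (hL : PicardVessiot.IsAS D L)
    (hconst : PicardVessiot.SameConstants R D K L) :
    List.TFAE [
      PicardVessiot.IsPVExtension R D K L ∧ PicardVessiot.IsFinitelyGenerated D K L,
      ∃ (V : Type u) (_ : AddCommGroup V) (_ : Module R V) (_ : Module K V) (_ : Module D V)
        (_ : IsScalarTower R K V) (_ : IsScalarTower R D V)
        (_ : PicardVessiot.IsSmashModule R D K V),
        PicardVessiot.IsCyclicModule D K V ∧ Module.Finite K V ∧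
          PicardVessiot.IsMinimalSplittingAlgebra R D K L V,
      ∃ (V : Type u) (_ : AddCommGroup V) (_ : Module R V) (_ : Module K V) (_ : Module D V)
        (_ : IsScalarTower R K V) (_ : IsScalarTower R D V)
        (_ : PicardVessiot.IsSmashModule R D K V),
        Module.Finite K V ∧ PicardVessiot.IsMinimalSplittingAlgebra R D K L V,
      ∃ (n : ℕ) (X : Matrix.GeneralLinearGroup (Fin n) L),
        PicardVessiot.IsGLPrimitive D K X ∧
          PicardVessiot.adjoin D K (Set.range fun p : Fin n × Fin n => X p.1 p.2) = ⊤] := by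
  have := hK.artinian
  have := hL.nontrivial
  tfae_have 1 → 4 := fun ⟨hPV, hfg⟩ =>
    PicardVessiot.exists_glPrimitive_of_pv hK hL hconst hPV hfg
  tfae_have 4 → 1 := by
    classical
    rintro ⟨n, X, hX, hgen⟩
    refine ⟨PicardVessiot.isPVExtension_of_glPrimitive hpointed hK hL hconst X hX hgen,
      Finset.univ.image fun p : Fin n × Fin n => X p.1 p.2, ?_⟩
    rwa [Finset.coe_image, Finset.coe_univ, Set.image_univ]
  tfae_have 4 → 2 := by
    rintro ⟨n, X, hX, hgen⟩
    obtain ⟨-, A, hfrac, hA⟩ :=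
      PicardVessiot.isPVExtension_of_glPrimitive hpointed hK hL hconst X hX hgen
    have := PicardVessiot.faithfullyFlat_of_pv hK hL A hfrac hA
    exact PicardVessiot.exists_cyclic_of_glPrimitive
      (PicardVessiot.algebraMap_injective hK) X hX hgen
  tfae_have 2 → 3 := fun ⟨V, i₁, i₂, i₃, i₄, i₅, i₆, i₇, _, hV⟩ =>
    ⟨V, i₁, i₂, i₃, i₄, i₅, i₆, i₇, hV⟩
  tfae_have 3 → 4 := by
    rintro ⟨V, _, _, _, _, _, _, _, _, ⟨Λ, φ, hφ, hact⟩, hgen⟩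
    obtain ⟨n, X, hX, hsol⟩ := PicardVessiot.exists_glPrimitive hK hL hconst φ hφ hact
    refine ⟨n, X, hX, PicardVessiot.adjoin_eq_top_iff.2 fun M hM hXM => ?_⟩
    exact PicardVessiot.adjoin_eq_top_iff.1 hgen M hM
      (hsol.trans (Algebra.adjoin_le (S := M.toSubalgebra) hXM))
  tfae_finish
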